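/- Let $c>1$ and $h>0$ be real numbers, and let $\{L_k\}_{k\in\mathbb Z}$ be the irreducible lowest weight representation, on a complex vector space $V$, of the Virasoro algebra $$[L_m,L_k]=(m-k)L_{m+k}+\tfrac{c}{12}(m^3-m)\,\delta_{m+k,0}\,\mathbf 1$$ with central charge $c$ and lowest weight $h$. That is, $V$ is irreducible and has a nonzero cyclic vector $\Omega$ with $L_k\Omega=0$ for all $k>0$ and $L_0\Omega=h\Omega$. Let $n\ge 0$ be an integer, and assume that $n\ge 1$ or $h\ge \frac{1}{5(c+1)}$. Then for every nonzero $\Psi\in V$ and every $\lambda\in\mathbb C$: $$\text{if}\quad L_0\Psi=(n+h)\Psi\quad\text{and}\quad \sum_{k\ge 0}L_{-k}L_k\Psi=\lambda\Psi,\quad\text{then}\quad |\lambda|\le 5(c+1)(n+h)^3 .$$ (The sum has only finitely many nonzero terms. In the excluded case $n=0$, $h<\frac1{5(c+1)}$, the vector $\Psi$ is a multiple of $\Omega$ and $\lambda=h^2>5(c+1)h^3$.) -/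

import Mathlib

/-- A representation of the Virasoro algebra with central charge `c` on a complex vector space
`V`: linear operators `L n`, `n : ℤ`, with
`[L m, L n] = (m - n) L (m + n) + (c / 12) (m ^ 3 - m) δ_{m + n, 0}`. -/
structure VirasoroRep (c : ℂ) (V : Type*) [AddCommGroup V] [Module ℂ V] where
  /-- The operators `L n`. -/
  L : ℤ → Module.End ℂ V
  comm : ∀ m n : ℤ, L m * L n - L n * L m =
    ((m : ℂ) - (n : ℂ)) • L (m + n) +
      (if m + n = 0 then c / 12 * ((m : ℂ) ^ 3 - (m : ℂ)) else 0) • (1 : Module.End ℂ V)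

namespace VirasoroRep

variable {c : ℂ} {V : Type*} [AddCommGroup V] [Module ℂ V]

/-- A subspace is invariant if every operator `L n` maps it into itself. -/
def IsInvariant (ρ : VirasoroRep c V) (W : Submodule ℂ V) : Prop :=
  ∀ n : ℤ, ∀ v ∈ W, ρ.L n v ∈ W

/-- Irreducibility: the space is nonzero and has only the two trivial invariant subspaces. -/
def IsIrreducible (ρ : VirasoroRep c V) : Prop :=
  Nontrivial V ∧ ∀ W : Submodule ℂ V, ρ.IsInvariant W → W = ⊥ ∨ W = ⊤

/-- `Ω` is a lowest weight vector of weight `h`: a nonzero cyclic vector with `L n Ω = 0` for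
`n > 0` and `L 0 Ω = h Ω`. -/
structure IsLowestWeightVector (ρ : VirasoroRep c V) (h : ℂ) (Ω : V) : Prop where
  ne_zero : Ω ≠ 0
  annihilated : ∀ n : ℤ, 0 < n → ρ.L n Ω = 0
  weight : ρ.L 0 Ω = h • Ω
  cyclic : ∀ W : Submodule ℂ V, ρ.IsInvariant W → Ω ∈ W → W = ⊤

/-- A lowest weight representation with lowest weight `h`. -/
def IsLowestWeightRep (ρ : VirasoroRep c V) (h : ℂ) : Prop :=
  ∃ Ω : V, ρ.IsLowestWeightVector h Ω

/-- The vector `∑_{k ≥ 0} L (-k) (L k Ψ)`. In a lowest weight representation the sum has only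
finitely many nonzero terms, see `IsLowestWeightRep.finite_support`. -/
noncomputable def sumLL (ρ : VirasoroRep c V) (Ψ : V) : V :=
  ∑ᶠ k : ℕ, ρ.L (-(k : ℤ)) (ρ.L (k : ℤ) Ψ)

/-- In a lowest weight representation every vector is annihilated by `L n` for all large `n`. -/
theorem IsLowestWeightRep.eventually_zero {ρ : VirasoroRep c V} {h : ℂ}
    (hρ : ρ.IsLowestWeightRep h) (Ψ : V) : ∃ N : ℤ, ∀ n : ℤ, N < n → ρ.L n Ψ = 0 := by
  obtain ⟨Ω, hΩ⟩ := hρ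
  let W : Submodule ℂ V :=
    { carrier := {v | ∃ N : ℤ, ∀ n : ℤ, N < n → ρ.L n v = 0}
      zero_mem' := ⟨0, fun n _ => map_zero _⟩
      add_mem' := by
        rintro a b ⟨N, hN⟩ ⟨M, hM⟩
        refine ⟨max N M, fun n hn => ?_⟩
        rw [map_add, hN n (lt_of_le_of_lt (le_max_left _ _) hn),
          hM n (lt_of_le_of_lt (le_max_right _ _) hn), add_zero]
      smul_mem' := by
        rintro a v ⟨N, hN⟩
        exact ⟨N, fun n hn => by rw [map_smul, hN n hn, smul_zero]⟩ }
  have hW : W = ⊤ := by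
    refine hΩ.cyclic W ?_ ⟨0, hΩ.annihilated⟩
    rintro m v ⟨N, hN⟩
    refine ⟨max (max N (N - m)) (-m), fun n hn => ?_⟩
    have h1 : N < n := by omega
    have h2 : N < n + m := by omega
    have h3 : ¬ n + m = 0 := by omega
    have key := congrArg (fun T : Module.End ℂ V => T v) (ρ.comm n m)
    simpa [h3, hN n h1, hN (n + m) h2] using key
  have hΨ : Ψ ∈ W := hW ▸ Submodule.mem_top
  exact hΨ

/-- In a lowest weight representation the sum defining `sumLL` is finite. -/
theorem IsLowestWeightRep.finite_support {ρ : VirasoroRep c V} {h : ℂ}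
    (hρ : ρ.IsLowestWeightRep h) (Ψ : V) :
    (Function.support fun k : ℕ => ρ.L (-(k : ℤ)) (ρ.L (k : ℤ) Ψ)).Finite := by
  obtain ⟨N, hN⟩ := hρ.eventually_zero Ψ
  refine (Set.finite_Iic N.toNat).subset fun k hk => ?_
  by_contra hk'
  have hlt : N < (k : ℤ) := by
    have : N.toNat < k := not_le.mp hk'
    omega
  exact hk (by simp only [hN _ hlt, map_zero])

end VirasoroRep

/-!
The bound is proved by realizing the Virasoro algebra on the Fock space `ℂ[X 0, X 1, …]` of a free
boson with charge `μ` and background charge `γ`, through the Sugawara formula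
`L n = 1/2 ∑ⱼ :a j a (n - j): + γ n a n - γ² / 2 δ_{n, 0}`. Its central charge is `1 - 12 γ²` and the
weight of its vacuum is `(μ² - γ²) / 2`, so complex square roots `γ`, `μ` realize every pair `c`, `h`;
for `c > 1` the parameter `γ` is imaginary. No unitarity is needed.

*The Fock representation.* The operators satisfy `[L n, a k] = -k a (n + k) + γ n² δ_{n + k, 0}`
(`HeisenbergRep.sugawara_comm`). Hence `[L m, L n] - (m - n) L (m + n)` commutes with all modes, so
that it is a scalar (`Fock.eq_smul_one_of_commute`), and the scalar is read off from the vacuum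
expectation values of `L m L n` (`Fock.constantCoeff_vir_vir_neg`).

*The estimate.* In the norm `Fock.coeffNorm`, the sum of the absolute values of the coefficients, the
operator `∑_{k ≥ 0} L (-k) L k` is bounded on the polynomials of level `n` by
`(n + h)² + n (n + |μ| + |γ| n) (3 n / 2 + |μ| + |γ| n)`. Indeed each `L (-k)` is bounded by
`n + |μ| + |γ| n` on the relevant level, and the norms of the vectors `L k X^d`, for a monomial `X^d`
of level `n`, add up to at most `n (3 n / 2 + |μ| + |γ| n)`, because the levels of the letters of
`X^d` add up to `n`. As `|γ|² = (c - 1) / 12` and `|μ|² ≤ 2 h + |γ|²`, this is below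
`5 (c + 1) (n + h)³` for `n ≥ 1`; for `n = 0` it is `h²`.

*The transfer.* The vector `(1, Ω)` generates an invariant subspace `D` of the direct sum of the Fock
space and `V`. By irreducibility `D` is the graph of a map from a subspace of the Fock space onto `V`
(`VirasoroRep.exists_invariant_graph`), so that `V` is a subquotient of the Fock space. The weight
spaces of the latter are finite-dimensional, and therefore an eigenvalue on `V` is an eigenvalue on
the Fock space (`VirasoroRep.exists_sumLL_eigenvector`).
-/

/-! ### Sugawara operators of a Heisenberg representation -/

/-- A representation of the Heisenberg algebra `[a m, a n] = m δ_{m + n, 0}` in which every vector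
is annihilated by `a j` for all large `j`. -/
structure HeisenbergRep (F : Type*) [AddCommGroup F] [Module ℂ F] where
  /-- The modes `a n`. -/
  a : ℤ → Module.End ℂ F
  comm : ∀ m n : ℤ, a m * a n - a n * a m = if m + n = 0 then (m : ℂ) • 1 else 0
  eventually_zero : ∀ f : F, ∃ N : ℕ, ∀ j : ℤ, (N : ℤ) < j → a j f = 0

namespace HeisenbergRep

variable {F : Type*} [AddCommGroup F] [Module ℂ F]

/-- The partial sum, over `j < M`, of the Sugawara operator
`L n = 1/2 ∑_{j ≥ 1} a (n - j) a j + 1/2 ∑_{j ≥ 0} a (-j) a (n + j) + γ n a n - γ² / 2 δ_{n, 0}`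
with background charge `γ`. Both sums are normally ordered up to the order of
commuting factors. -/
noncomputable def sugawaraTrunc (H : HeisenbergRep F) (γ : ℂ) (M : ℕ) (n : ℤ) : Module.End ℂ F :=
  (1 / 2 : ℂ) • (∑ j ∈ Finset.range M, H.a (n - (j + 1)) * H.a (j + 1)) +
  (1 / 2 : ℂ) • (∑ j ∈ Finset.range M, H.a (-j) * H.a (n + j)) +
  (γ * n) • H.a n + (if n = 0 then -γ ^ 2 / 2 else 0) • 1

theorem exists_sugawaraTrunc_eq (H : HeisenbergRep F) (γ : ℂ) (n : ℤ) (f : F) :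
    ∃ N : ℕ, ∀ M, N ≤ M → H.sugawaraTrunc γ M n f = H.sugawaraTrunc γ N n f := by
  obtain ⟨N, hN⟩ := H.eventually_zero f
  refine ⟨N + n.natAbs + 1, fun M hM => ?_⟩
  have key : ∀ g : ℕ → Module.End ℂ F, (∀ j, N + n.natAbs + 1 ≤ j → g j f = 0) →
      (∑ j ∈ Finset.range M, g j) f = (∑ j ∈ Finset.range (N + n.natAbs + 1), g j) f := by
    intro g hg
    rw [LinearMap.sum_apply, LinearMap.sum_apply]
    refine (Finset.sum_subset (Finset.range_mono hM) fun j _ hj => hg j ?_).symm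
    simpa using hj
  simp only [sugawaraTrunc, LinearMap.add_apply, LinearMap.smul_apply]
  rw [key, key]
  · intro j hj
    rw [Module.End.mul_apply, hN _ (by omega), map_zero]
  · intro j hj
    rw [Module.End.mul_apply, hN _ (by omega), map_zero]

/-- The Sugawara operator `L n` with background charge `γ`; its value on a vector is that of a
sufficiently long partial sum. -/
noncomputable def sugawara (H : HeisenbergRep F) (γ : ℂ) (n : ℤ) : Module.End ℂ F where
  toFun f := H.sugawaraTrunc γ (H.exists_sugawaraTrunc_eq γ n f).choose n f
  map_add' f g := by
    have h1 := (H.exists_sugawaraTrunc_eq γ n f).choose_spec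
    have h2 := (H.exists_sugawaraTrunc_eq γ n g).choose_spec
    have h3 := (H.exists_sugawaraTrunc_eq γ n (f + g)).choose_spec
    set N1 := (H.exists_sugawaraTrunc_eq γ n f).choose
    set N2 := (H.exists_sugawaraTrunc_eq γ n g).choose
    set N3 := (H.exists_sugawaraTrunc_eq γ n (f + g)).choose
    rw [← h1 (N1 + N2 + N3) (by omega), ← h2 (N1 + N2 + N3) (by omega),
      ← h3 (N1 + N2 + N3) (by omega), map_add]
  map_smul' z f := by
    have h1 := (H.exists_sugawaraTrunc_eq γ n f).choose_spec
    have h2 := (H.exists_sugawaraTrunc_eq γ n (z • f)).choose_spec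
    set N1 := (H.exists_sugawaraTrunc_eq γ n f).choose
    set N2 := (H.exists_sugawaraTrunc_eq γ n (z • f)).choose
    rw [← h1 (N1 + N2) (by omega), ← h2 (N1 + N2) (by omega), map_smul, RingHom.id_apply]

theorem eventually_sugawara_eq (H : HeisenbergRep F) (γ : ℂ) (n : ℤ) (f : F) :
    ∃ N : ℕ, ∀ M, N ≤ M → H.sugawara γ n f = H.sugawaraTrunc γ M n f :=
  ⟨_, fun M hM => ((H.exists_sugawaraTrunc_eq γ n f).choose_spec M hM).symm⟩

theorem sum_range_ite_of_iff {E : Type*} [AddCommMonoid E] {P : ℕ → Prop} [DecidablePred P]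
    (M : ℕ) (z : ℤ) (hz : z < M) (hP : ∀ j : ℕ, P j ↔ (j : ℤ) = z) (g : ℤ → E) :
    ∑ j ∈ Finset.range M, (if P j then g j else 0) = if 0 ≤ z then g z else 0 := by
  split_ifs with h
  · lift z to ℕ using h
    rw [Finset.sum_eq_single z]
    · rw [if_pos ((hP z).2 rfl)]
    · intro b _ hb
      rw [if_neg fun h => hb (by exact_mod_cast (hP b).1 h)]
    · intro h'
      simp at h' hz
      omega
  · refine Finset.sum_eq_zero fun j _ => if_neg fun hj => ?_
    have := (hP j).1 hj
    omega

theorem mul_comm_sub (H : HeisenbergRep F) (x y k : ℤ) :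
    H.a x * H.a y * H.a k - H.a k * (H.a x * H.a y) =
      (if y = -k then (y : ℂ) • H.a x else 0) + (if x = -k then (x : ℂ) • H.a y else 0) := by
  have h1 := H.comm y k
  have h2 := H.comm x k
  have : H.a x * H.a y * H.a k - H.a k * (H.a x * H.a y) =
    H.a x * (H.a y * H.a k - H.a k * H.a y) + (H.a x * H.a k - H.a k * H.a x) * H.a y := by
    noncomm_ring
  rw [this, h1, h2]
  congr 1
  · by_cases h : y = -k
    · rw [if_pos h, if_pos (by omega)]; simp
    · rw [if_neg h, if_neg (by omega)]; simp
  · by_cases h : x = -k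
    · rw [if_pos h, if_pos (by omega)]; simp
    · rw [if_neg h, if_neg (by omega)]; simp

theorem sugawaraTrunc_comm (H : HeisenbergRep F) (γ : ℂ) (n k : ℤ) (M : ℕ)
    (hM : n.natAbs + k.natAbs < M) :
    H.sugawaraTrunc γ M n * H.a k - H.a k * H.sugawaraTrunc γ M n =
      -(k : ℂ) • H.a (n + k) + (if n + k = 0 then γ * n ^ 2 else 0) • 1 := by
  have e1 : (∑ j ∈ Finset.range M, H.a (n - (j + 1)) * H.a (j + 1)) * H.a k -
      H.a k * (∑ j ∈ Finset.range M, H.a (n - (j + 1)) * H.a (j + 1)) =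
      (if k < 0 then -(k : ℂ) • H.a (n + k) else 0) +
      (if 0 < n + k then -(k : ℂ) • H.a (n + k) else 0) := by
    rw [Finset.sum_mul, Finset.mul_sum, ← Finset.sum_sub_distrib]
    simp only [mul_comm_sub, Finset.sum_add_distrib]
    congr 1
    · refine (sum_range_ite_of_iff M (-k - 1) (by omega) (fun j => by omega)
        (fun j : ℤ => ((j + 1 : ℤ) : ℂ) • H.a (n - (j + 1)))).trans ?_
      by_cases h : k < 0
      · rw [if_pos h, if_pos (by omega)]
        congr 2 <;> push_cast <;> ring
      · rw [if_neg h, if_neg (by omega)]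
    · refine (sum_range_ite_of_iff M (n + k - 1) (by omega) (fun j => by omega)
        (fun j : ℤ => ((n - (j + 1) : ℤ) : ℂ) • H.a (j + 1))).trans ?_
      by_cases h : 0 < n + k
      · rw [if_pos h, if_pos (by omega)]
        congr 2 <;> push_cast <;> ring
      · rw [if_neg h, if_neg (by omega)]
  have e2 : (∑ j ∈ Finset.range M, H.a (-j) * H.a (n + j)) * H.a k -
      H.a k * (∑ j ∈ Finset.range M, H.a (-j) * H.a (n + j)) =
      (if 0 < n + k then 0 else -(k : ℂ) • H.a (n + k)) +
      (if k < 0 then 0 else -(k : ℂ) • H.a (n + k)) := by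
    rw [Finset.sum_mul, Finset.mul_sum, ← Finset.sum_sub_distrib]
    simp only [mul_comm_sub, Finset.sum_add_distrib]
    congr 1
    · refine (sum_range_ite_of_iff M (-n - k) (by omega) (fun j => by omega)
        (fun j : ℤ => ((n + j : ℤ) : ℂ) • H.a (-j))).trans ?_
      by_cases h : 0 < n + k
      · rw [if_pos h, if_neg (by omega)]
      · rw [if_neg h, if_pos (by omega)]
        congr 2 <;> push_cast <;> ring
    · refine (sum_range_ite_of_iff M k (by omega) (fun j => by omega)
        (fun j : ℤ => ((-j : ℤ) : ℂ) • H.a (n + j))).trans ?_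
      by_cases h : k < 0
      · rw [if_pos h, if_neg (by omega)]
      · rw [if_neg h, if_pos (by omega)]
        push_cast
        rfl
  have e3 : H.a n * H.a k - H.a k * H.a n = (if n + k = 0 then (n : ℂ) else 0) • 1 := by
    rw [H.comm]; split_ifs <;> simp
  have : H.sugawaraTrunc γ M n * H.a k - H.a k * H.sugawaraTrunc γ M n =
      (1 / 2 : ℂ) • ((∑ j ∈ Finset.range M, H.a (n - (j + 1)) * H.a (j + 1)) * H.a k -
        H.a k * (∑ j ∈ Finset.range M, H.a (n - (j + 1)) * H.a (j + 1))) +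
      (1 / 2 : ℂ) • ((∑ j ∈ Finset.range M, H.a (-j) * H.a (n + j)) * H.a k -
        H.a k * (∑ j ∈ Finset.range M, H.a (-j) * H.a (n + j))) +
      (γ * n) • (H.a n * H.a k - H.a k * H.a n) := by
    simp only [sugawaraTrunc, add_mul, mul_add, smul_mul_assoc, mul_smul_comm, one_mul, mul_one,
      smul_sub]
    abel
  have e4 : γ * n * (if n + k = 0 then (n : ℂ) else 0) =
      if n + k = 0 then γ * n ^ 2 else 0 := by
    split_ifs <;> ring
  rw [this, e1, e2, e3, smul_smul, e4]
  -- each of the two sign conditions is met in exactly one of the two sums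
  by_cases h1 : k < 0 <;> by_cases h2 : 0 < n + k
  all_goals
    simp only [h1, h2, if_true, if_false]
    module

/-- The commutation relation of the Sugawara operators with the Heisenberg modes. -/
theorem sugawara_comm (H : HeisenbergRep F) (γ : ℂ) (n k : ℤ) :
    H.sugawara γ n * H.a k = H.a k * H.sugawara γ n +
      (-(k : ℂ) • H.a (n + k) + (if n + k = 0 then γ * n ^ 2 else 0) • 1) := by
  rw [← sub_eq_iff_eq_add']
  ext f
  obtain ⟨N1, h1⟩ := H.eventually_sugawara_eq γ n f
  obtain ⟨N2, h2⟩ := H.eventually_sugawara_eq γ n (H.a k f)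
  rw [← H.sugawaraTrunc_comm γ n k (N1 + N2 + n.natAbs + k.natAbs + 1) (by omega)]
  simp only [LinearMap.sub_apply, Module.End.mul_apply]
  rw [h1 (N1 + N2 + n.natAbs + k.natAbs + 1) (by omega),
    h2 (N1 + N2 + n.natAbs + k.natAbs + 1) (by omega)]

/-- The defect of the Virasoro relation commutes with all Heisenberg modes, by the Jacobi
identity. -/
theorem sugawara_defect_comm (H : HeisenbergRep F) (γ : ℂ) (m n k : ℤ) :
    (H.sugawara γ m * H.sugawara γ n - H.sugawara γ n * H.sugawara γ m -
      ((m : ℂ) - n) • H.sugawara γ (m + n)) * H.a k =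
    H.a k * (H.sugawara γ m * H.sugawara γ n - H.sugawara γ n * H.sugawara γ m -
      ((m : ℂ) - n) • H.sugawara γ (m + n)) := by
  have e1 : ∀ m n : ℤ, H.sugawara γ m * H.sugawara γ n * H.a k =
      H.a k * (H.sugawara γ m * H.sugawara γ n) + -(k : ℂ) • (H.a (m + k) * H.sugawara γ n) +
      (if m + k = 0 then γ * m ^ 2 else 0) • H.sugawara γ n +
      -(k : ℂ) • (H.a (n + k) * H.sugawara γ m) +
      (if n + k = 0 then γ * n ^ 2 else 0) • H.sugawara γ m +
      ((k : ℂ) * (n + k)) • H.a (m + n + k) +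
      -((k : ℂ) * (if m + n + k = 0 then γ * m ^ 2 else 0)) • 1 := by
    intro m n
    rw [mul_assoc, H.sugawara_comm, mul_add, ← mul_assoc, H.sugawara_comm, mul_add, mul_smul_comm,
      H.sugawara_comm γ m (n + k), add_mul, add_mul, smul_mul_assoc, smul_mul_assoc,
      mul_smul_comm, mul_one, one_mul, ← add_assoc m n k, mul_assoc]
    push_cast
    module
  rw [sub_mul, sub_mul, e1 m n, e1 n m, smul_mul_assoc, H.sugawara_comm, mul_sub, mul_sub,
    mul_smul_comm, add_comm n m]
  by_cases h : m + n + k = 0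
  · have hk : (k : ℂ) = -m - n := by
      have : k = -m - n := by omega
      rw [this]; push_cast; ring
    simp only [h, if_true, hk]
    push_cast
    module
  · simp only [h, if_false]
    module

end HeisenbergRep

/-! ### The Fock representation -/

open MvPolynomial in
/-- The modes of the Heisenberg algebra on the Fock space `ℂ[X 0, X 1, …]`: the creation operator
`a (-(k + 1))` is multiplication by `X k`, the annihilation operator `a (k + 1)` is
`(k + 1) ∂ / ∂ X k`, and `a 0` is the scalar `μ`. -/
noncomputable def fockMode (μ : ℂ) : ℤ → Module.End ℂ (MvPolynomial ℕ ℂ)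
  | .ofNat 0 => μ • 1
  | .ofNat (k + 1) => ((k : ℂ) + 1) • (pderiv k).toLinearMap
  | .negSucc k => LinearMap.mulLeft ℂ (X k)

namespace Fock

open MvPolynomial

variable (μ γ : ℂ)

theorem mode_zero_apply (f : MvPolynomial ℕ ℂ) : fockMode μ 0 f = μ • f := rfl

theorem mode_pos_apply (k : ℕ) (f : MvPolynomial ℕ ℂ) :
    fockMode μ ((k : ℤ) + 1) f = ((k : ℂ) + 1) • pderiv k f := rfl

theorem mode_neg_apply (k : ℕ) (f : MvPolynomial ℕ ℂ) :
    fockMode μ (-((k : ℤ) + 1)) f = X k * f := by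
  rw [show -((k : ℤ) + 1) = Int.negSucc k from rfl]
  rfl

theorem int_cases (z : ℤ) : z = 0 ∨ (∃ k : ℕ, z = k + 1) ∨ ∃ k : ℕ, z = -((k : ℤ) + 1) := by
  rcases lt_trichotomy z 0 with h | h | h
  · exact Or.inr (Or.inr ⟨(-z - 1).toNat, by omega⟩)
  · exact Or.inl h
  · exact Or.inr (Or.inl ⟨(z - 1).toNat, by omega⟩)

theorem pderiv_comm (i j : ℕ) (f : MvPolynomial ℕ ℂ) :
    pderiv i (pderiv j f) = pderiv j (pderiv i f) := by
  let D : ℕ → Derivation ℂ (MvPolynomial ℕ ℂ) (MvPolynomial ℕ ℂ) := fun i => pderiv i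
  have h : ⁅D i, D j⁆ = 0 := by
    refine MvPolynomial.derivation_ext fun k => ?_
    rw [Derivation.commutator_apply]
    simp only [D, pderiv_X, Pi.single_apply]
    split_ifs <;> simp
  have h' := congrArg (fun E : Derivation ℂ (MvPolynomial ℕ ℂ) (MvPolynomial ℕ ℂ) => E f) h
  simpa [D, Derivation.commutator_apply, sub_eq_zero] using h'

theorem mode_comm (m n : ℤ) : fockMode μ m * fockMode μ n - fockMode μ n * fockMode μ m =
    if m + n = 0 then (m : ℂ) • 1 else 0 := by
  refine LinearMap.ext fun f => ?_
  rw [LinearMap.sub_apply, Module.End.mul_apply, Module.End.mul_apply]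
  obtain rfl | ⟨i, rfl⟩ | ⟨i, rfl⟩ := int_cases m <;>
    obtain rfl | ⟨j, rfl⟩ | ⟨j, rfl⟩ := int_cases n <;>
    simp only [mode_zero_apply, mode_pos_apply, mode_neg_apply, map_smul, sub_self]
  · simp
  · rw [if_neg (by omega), smul_comm, sub_self]; rfl
  · rw [if_neg (by omega)]; rfl
  · rw [if_neg (by omega), smul_comm, sub_self]; rfl
  · rw [if_neg (by omega), smul_comm, pderiv_comm, sub_self]; rfl
  · rw [pderiv_mul, pderiv_X, Pi.single_apply]
    by_cases h : j = i
    · subst h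
      simp [smul_add]
    · rw [if_neg h, if_neg (by omega)]
      simp
  · rw [if_neg (by omega)]; rfl
  · rw [pderiv_mul, pderiv_X, Pi.single_apply]
    by_cases h : i = j
    · subst h
      rw [if_pos rfl, if_pos (by omega), LinearMap.smul_apply, Module.End.one_apply]
      push_cast
      rw [one_mul]
      module
    · rw [if_neg h, if_neg (by omega)]
      simp
  · rw [if_neg (by omega), mul_left_comm, sub_self]; rfl

theorem mode_eventually_zero (f : MvPolynomial ℕ ℂ) :
    ∃ N : ℕ, ∀ j : ℤ, (N : ℤ) < j → fockMode μ j f = 0 := by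
  obtain ⟨N, hN⟩ := f.vars.bddAbove
  refine ⟨N + 1, fun j hj => ?_⟩
  lift j to ℕ using by omega
  obtain ⟨k, rfl⟩ : ∃ k, j = k + 1 := ⟨j - 1, by omega⟩
  push_cast
  rw [mode_pos_apply, pderiv_eq_zero_of_notMem_vars, smul_zero]
  intro hk
  have := hN (Finset.mem_coe.2 hk)
  omega

/-- The Fock representation of the Heisenberg algebra of charge `μ`. -/
noncomputable def heisenberg : HeisenbergRep (MvPolynomial ℕ ℂ) where
  a := fockMode μ
  comm := mode_comm μ
  eventually_zero := mode_eventually_zero μ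

/-- The Virasoro operators of the Fock space with background charge `γ`. -/
noncomputable abbrev vir (n : ℤ) : Module.End ℂ (MvPolynomial ℕ ℂ) :=
  (heisenberg μ).sugawara γ n

/-- The lowest weight of the Fock representation. -/
noncomputable def weight : ℂ := (μ ^ 2 - γ ^ 2) / 2

/-- The Fock representation is irreducible in the sense of Schur's lemma: an operator commuting
with all modes is a scalar. -/
theorem eq_smul_one_of_commute (T : Module.End ℂ (MvPolynomial ℕ ℂ))
    (hT : ∀ k, T * fockMode μ k = fockMode μ k * T) : T = constantCoeff (T 1) • 1 := by
  have hX : ∀ i f, T (X i * f) = X i * T f := by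
    intro i f
    have := congrArg (fun S : Module.End ℂ (MvPolynomial ℕ ℂ) => S f) (hT (-((i : ℤ) + 1)))
    simpa only [Module.End.mul_apply, mode_neg_apply] using this
  have hD : ∀ i, pderiv i (T 1) = 0 := by
    intro i
    have := congrArg (fun S : Module.End ℂ (MvPolynomial ℕ ℂ) => S 1) (hT ((i : ℤ) + 1))
    simp only [Module.End.mul_apply, mode_pos_apply, pderiv_one, smul_zero, map_zero] at this
    exact (smul_eq_zero.1 this.symm).resolve_left (Nat.cast_add_one_ne_zero i)
  have hC : T 1 = C (constantCoeff (T 1)) := by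
    ext m
    rw [coeff_C]
    split_ifs with hm
    · rw [← hm, constantCoeff_eq]
    · obtain ⟨i, hi⟩ : ∃ i, m i ≠ 0 := by
        by_contra! h
        exact hm (Finsupp.ext h).symm
      have := coeff_pderiv (i := i) (T 1) (m - Finsupp.single i 1)
      rw [hD, coeff_zero, Finsupp.sub_add_single_one_cancel hi] at this
      exact (mul_eq_zero.1 this.symm).resolve_right (Nat.cast_add_one_ne_zero _)
  refine LinearMap.ext fun f => ?_
  rw [LinearMap.smul_apply, Module.End.one_apply]
  induction f using MvPolynomial.induction_on with
  | C z =>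
    rw [← mul_one (C z), C_mul', map_smul, smul_comm]
    congr 1
    rw [← C_mul', mul_one]
    exact hC
  | add p q hp hq => rw [map_add, hp, hq, smul_add]
  | mul_X p i hp => rw [mul_comm, hX, hp, mul_smul_comm]

theorem constantCoeff_mode_neg (j : ℤ) (hj : j < 0) (f : MvPolynomial ℕ ℂ) :
    constantCoeff (fockMode μ j f) = 0 := by
  obtain rfl | ⟨i, rfl⟩ | ⟨i, rfl⟩ := int_cases j
  · omega
  · omega
  · rw [mode_neg_apply, map_mul, constantCoeff_X, zero_mul]

theorem mode_pos_one (j : ℤ) (hj : 0 < j) : fockMode μ j 1 = 0 := by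
  obtain rfl | ⟨i, rfl⟩ | ⟨i, rfl⟩ := int_cases j
  · omega
  · rw [mode_pos_apply, pderiv_one, smul_zero]
  · omega

theorem constantCoeff_smul (z : ℂ) (f : MvPolynomial ℕ ℂ) :
    constantCoeff (z • f) = z * constantCoeff f := by
  rw [smul_eq_C_mul, map_mul, constantCoeff_C]

theorem constantCoeff_vir_neg (n : ℤ) (hn : n < 0) (f : MvPolynomial ℕ ℂ) :
    constantCoeff (vir μ γ n f) = 0 := by
  obtain ⟨N, hN⟩ := (heisenberg μ).eventually_sugawara_eq γ n f
  rw [hN N le_rfl]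
  simp only [HeisenbergRep.sugawaraTrunc, heisenberg, LinearMap.add_apply, LinearMap.smul_apply,
    LinearMap.sum_apply, Module.End.mul_apply, map_add, constantCoeff_smul, map_sum]
  rw [Finset.sum_eq_zero, Finset.sum_eq_zero, constantCoeff_mode_neg μ n hn, if_neg hn.ne]
  · simp
  · intro j _
    obtain rfl | h := Nat.eq_zero_or_pos j
    · simp [mode_zero_apply, constantCoeff_mode_neg μ n hn]
    · rw [constantCoeff_mode_neg μ _ (by omega)]
  · intro j _
    rw [constantCoeff_mode_neg μ _ (by omega)]

theorem constantCoeff_vir_zero (f : MvPolynomial ℕ ℂ) :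
    constantCoeff (vir μ γ 0 f) = weight μ γ * constantCoeff f := by
  obtain ⟨N, hN⟩ := (heisenberg μ).eventually_sugawara_eq γ 0 f
  rw [hN (N + 1) (by omega)]
  simp only [HeisenbergRep.sugawaraTrunc, heisenberg, LinearMap.add_apply, LinearMap.smul_apply,
    LinearMap.sum_apply, Module.End.mul_apply, map_add, constantCoeff_smul, map_sum]
  rw [Finset.sum_eq_zero, Finset.sum_eq_single 0]
  · simp [mode_zero_apply, weight]
    ring
  · intro j _ hj
    rw [constantCoeff_mode_neg μ _ (by omega)]
  · simp
  · intro j _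
    rw [constantCoeff_mode_neg μ _ (by omega)]

theorem vir_pos_one (n : ℤ) (hn : 0 < n) : vir μ γ n 1 = 0 := by
  obtain ⟨N, hN⟩ := (heisenberg μ).eventually_sugawara_eq γ n 1
  rw [hN N le_rfl]
  simp only [HeisenbergRep.sugawaraTrunc, heisenberg, LinearMap.add_apply, LinearMap.smul_apply,
    LinearMap.sum_apply, Module.End.mul_apply]
  rw [Finset.sum_eq_zero, Finset.sum_eq_zero, mode_pos_one μ n hn, if_neg hn.ne']
  · simp
  · intro j _
    rw [mode_pos_one μ _ (by omega), map_zero]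
  · intro j _
    rw [mode_pos_one μ _ (by omega), map_zero]

theorem vir_zero_one : vir μ γ 0 1 = weight μ γ • 1 := by
  obtain ⟨N, hN⟩ := (heisenberg μ).eventually_sugawara_eq γ 0 1
  rw [hN (N + 1) (by omega)]
  simp only [HeisenbergRep.sugawaraTrunc, heisenberg, LinearMap.add_apply, LinearMap.smul_apply,
    LinearMap.sum_apply, Module.End.mul_apply]
  rw [Finset.sum_eq_zero, Finset.sum_eq_single 0]
  · simp only [Nat.cast_zero, neg_zero, zero_add, mode_zero_apply, weight, map_smul, Int.cast_zero,
      if_true, Module.End.one_apply]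
    module
  · intro j _ hj
    rw [mode_pos_one μ _ (by omega), map_zero]
  · simp
  · intro j _
    rw [mode_pos_one μ _ (by omega), map_zero]

theorem constantCoeff_vir_one (n : ℤ) :
    constantCoeff (vir μ γ n 1) = if n = 0 then weight μ γ else 0 := by
  obtain h | rfl | h := lt_trichotomy n 0
  · rw [constantCoeff_vir_neg μ γ n h, if_neg h.ne]
  · rw [constantCoeff_vir_zero, map_one, mul_one, if_pos rfl]
  · rw [vir_pos_one μ γ n h, if_neg h.ne', map_zero]

/-- The defect of the Virasoro relation is a scalar, which can be read off on the vacuum. -/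
theorem vir_defect (m n : ℤ) :
    vir μ γ m * vir μ γ n - vir μ γ n * vir μ γ m - ((m : ℂ) - n) • vir μ γ (m + n) =
      (constantCoeff (vir μ γ m (vir μ γ n 1)) - constantCoeff (vir μ γ n (vir μ γ m 1)) -
        ((m : ℂ) - n) * (if m + n = 0 then weight μ γ else 0)) • 1 := by
  rw [eq_smul_one_of_commute μ _ fun k => (heisenberg μ).sugawara_defect_comm γ m n k]
  simp only [LinearMap.sub_apply, LinearMap.smul_apply, Module.End.mul_apply, map_sub,
    constantCoeff_smul, constantCoeff_vir_one]

theorem vir_zero_vir (n : ℤ) (f : MvPolynomial ℕ ℂ) :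
    vir μ γ 0 (vir μ γ n f) = vir μ γ n (vir μ γ 0 f) - (n : ℂ) • vir μ γ n f := by
  have h := congrArg (fun S : Module.End ℂ (MvPolynomial ℕ ℂ) => S f) (vir_defect μ γ 0 n)
  simp only [vir_zero_one, constantCoeff_vir_zero, map_smul, constantCoeff_smul, sub_self, zero_add,
    constantCoeff_vir_one] at h
  have h0 : -(0 - (n : ℂ)) * (if n = 0 then weight μ γ else 0) = 0 := by
    split_ifs with hn
    · simp [hn]
    · simp
  simp only [LinearMap.sub_apply, LinearMap.smul_apply, Module.End.mul_apply, Int.cast_zero,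
    zero_sub, Module.End.one_apply] at h h0
  rw [← neg_mul, h0, zero_smul] at h
  rw [← sub_eq_zero, ← h]
  module

theorem constantCoeff_vir_vir_of_ne (m n : ℤ) (hmn : m + n ≠ 0) :
    constantCoeff (vir μ γ m (vir μ γ n 1)) = 0 := by
  have h := congrArg constantCoeff (vir_zero_vir μ γ m (vir μ γ n 1))
  rw [vir_zero_vir μ γ n 1, vir_zero_one, constantCoeff_vir_zero] at h
  simp only [map_sub, map_smul, constantCoeff_smul] at h
  have h2 : ((m : ℂ) + n) * constantCoeff (vir μ γ m (vir μ γ n 1)) = 0 := by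
    linear_combination h
  exact (mul_eq_zero.1 h2).resolve_left (by exact_mod_cast hmn)

theorem vir_mode (n k : ℤ) (f : MvPolynomial ℕ ℂ) :
    vir μ γ n (fockMode μ k f) = fockMode μ k (vir μ γ n f) +
      (-(k : ℂ) • fockMode μ (n + k) f + (if n + k = 0 then γ * n ^ 2 else 0) • f) := by
  have := congrArg (fun S : Module.End ℂ (MvPolynomial ℕ ℂ) => S f)
    ((heisenberg μ).sugawara_comm γ n k)
  simp only [LinearMap.add_apply, LinearMap.smul_apply, Module.End.mul_apply,
    Module.End.one_apply] at this
  exact this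

theorem sum_range_mul_sub (m : ℕ) (x : ℂ) : ∑ j ∈ Finset.range m, (j : ℂ) * (x - j) =
    x * (m * (m - 1) / 2) - m * (m - 1) * (2 * m - 1) / 6 := by
  induction m with
  | zero => simp
  | succ m ih =>
    rw [Finset.sum_range_succ, ih]
    push_cast
    ring

/-- The vacuum expectation value of `L m L (-m)`, from which the central charge is read off. -/
theorem constantCoeff_vir_vir_neg (m : ℕ) (hm : 0 < m) :
    constantCoeff (vir μ γ m (vir μ γ (-m) 1)) =
      2 * m * weight μ γ + (1 - 12 * γ ^ 2) / 12 * ((m : ℂ) ^ 3 - m) := by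
  have hu : constantCoeff (vir μ γ m (fockMode μ (-m) 1)) = m * μ + γ * m ^ 2 := by
    rw [vir_mode, vir_pos_one μ γ m (by omega), map_zero, add_neg_cancel, mode_zero_apply]
    simp
  have ht : ∀ j : ℕ, constantCoeff (vir μ γ m (fockMode μ (-j) (fockMode μ (-m + j) 1))) =
      (if j < m then (j : ℂ) * (m - j) else 0) + (if j = 0 then μ * (m * μ + γ * m ^ 2) else 0) +
        (if j = m then μ * (m * μ + γ * m ^ 2) else 0) := by
    intro j
    obtain rfl | hj := Nat.eq_zero_or_pos j
    · rw [if_pos hm, if_pos rfl, if_neg hm.ne]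
      simp [mode_zero_apply, hu]
    rw [if_neg hj.ne']
    obtain h | rfl | h := lt_trichotomy j m
    · rw [if_pos h, if_neg h.ne, vir_mode, map_add, constantCoeff_mode_neg μ _ (by omega),
        if_neg (by omega)]
      obtain ⟨k, hk⟩ : ∃ k, m = j + k + 1 := ⟨m - j - 1, by omega⟩
      rw [show (m : ℤ) + -j = (k : ℤ) + 1 by omega, show -(m : ℤ) + j = -((k : ℤ) + 1) by omega,
        mode_pos_apply, mode_neg_apply, hk]
      simp only [pderiv_X_self, constantCoeff_smul, map_add, map_one, add_zero, mul_one, zero_mul]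
      push_cast
      ring
    · rw [if_neg (lt_irrefl _), if_pos rfl, neg_add_cancel, mode_zero_apply, map_smul, map_smul,
        constantCoeff_smul, hu]
      ring
    · rw [if_neg (by omega), if_neg h.ne', mode_pos_one μ _ (by omega)]
      simp
  obtain ⟨N, hN⟩ := (heisenberg μ).eventually_sugawara_eq γ (-m) 1
  rw [hN (N + m + 1) (by omega)]
  simp only [HeisenbergRep.sugawaraTrunc, heisenberg, LinearMap.add_apply, LinearMap.smul_apply,
    LinearMap.sum_apply, Module.End.mul_apply, map_add, map_smul, constantCoeff_smul, map_sum, ht,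
    hu]
  rw [Finset.sum_eq_zero fun j _ => by
      rw [mode_pos_one μ _ (by omega), map_zero, map_zero, map_zero],
    Finset.sum_add_distrib, Finset.sum_add_distrib, Finset.sum_ite_eq', Finset.sum_ite_eq',
    ← Finset.sum_filter, if_pos (by simp), if_pos (by simp), if_neg (by omega)]
  have hf : (Finset.range (N + m + 1)).filter (· < m) = Finset.range m := by
    ext j
    simp
    omega
  rw [hf, sum_range_mul_sub, weight]
  push_cast
  simp only [zero_mul, add_zero, mul_zero]
  ring

/-- The Fock representation of the Virasoro algebra, of central charge `1 - 12 γ²`. -/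
noncomputable def virasoro : VirasoroRep (1 - 12 * γ ^ 2) (MvPolynomial ℕ ℂ) where
  L := vir μ γ
  comm m n := by
    rw [← sub_eq_iff_eq_add', vir_defect]
    congr 1
    by_cases hmn : m + n = 0
    · obtain rfl : n = -m := by omega
      rw [if_pos hmn, if_pos hmn]
      obtain hm | rfl | hm := lt_trichotomy m 0
      · obtain ⟨k, rfl⟩ : ∃ k : ℕ, m = -k := ⟨(-m).toNat, by omega⟩
        rw [neg_neg, constantCoeff_vir_neg μ γ _ hm, constantCoeff_vir_vir_neg μ γ k (by omega)]
        push_cast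
        ring
      · simp
      · lift m to ℕ using hm.le
        rw [constantCoeff_vir_neg μ γ (-m) (by omega),
          constantCoeff_vir_vir_neg μ γ m (by omega)]
        push_cast
        ring
    · rw [if_neg hmn, if_neg hmn, constantCoeff_vir_vir_of_ne μ γ m n hmn,
        constantCoeff_vir_vir_of_ne μ γ n m (by omega)]
      simp

end Fock

/-! ### Lowest weight vectors and subquotients -/

namespace VirasoroRep

variable {c : ℂ} {V E : Type*} [AddCommGroup V] [Module ℂ V] [AddCommGroup E] [Module ℂ E]

theorem L_comm_apply (ρ : VirasoroRep c V) (m n : ℤ) (v : V) :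
    ρ.L m (ρ.L n v) = ρ.L n (ρ.L m v) + ((m : ℂ) - n) • ρ.L (m + n) v +
      (if m + n = 0 then c / 12 * ((m : ℂ) ^ 3 - m) else 0) • v := by
  have h := congrArg (fun T : Module.End ℂ V => T v) (ρ.comm m n)
  simp only [LinearMap.sub_apply, LinearMap.add_apply, LinearMap.smul_apply,
    Module.End.mul_apply, Module.End.one_apply] at h
  rw [sub_eq_iff_eq_add'] at h
  rw [h, add_assoc]

theorem L_zero_L (ρ : VirasoroRep c V) (n : ℤ) (v : V) :
    ρ.L 0 (ρ.L n v) = ρ.L n (ρ.L 0 v) - (n : ℂ) • ρ.L n v := by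
  rw [L_comm_apply, zero_add]
  simp only [Int.cast_zero]
  split_ifs <;> module

theorem L_mem_eigenspace (ρ : VirasoroRep c V) (n : ℤ) {z : ℂ} {v : V}
    (hv : ρ.L 0 v = z • v) : ρ.L 0 (ρ.L n v) = (z - n) • ρ.L n v := by
  rw [L_zero_L, hv, map_smul, sub_smul]

/-- The vector `L (-(k₁ + 1)) ⋯ L (-(kᵣ + 1)) v` attached to the list `[k₁, …, kᵣ]`. -/
def word (ρ : VirasoroRep c V) (v : V) : List ℕ → V
  | [] => v
  | k :: l => ρ.L (-((k : ℤ) + 1)) (word ρ v l)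

/-- The amount by which a word raises the eigenvalue of `L 0`. -/
def wordLevel (l : List ℕ) : ℕ := (l.map (· + 1)).sum

theorem L_zero_word (ρ : VirasoroRep c V) {h : ℂ} {v : V} (hv : ρ.L 0 v = h • v) (l : List ℕ) :
    ρ.L 0 (ρ.word v l) = ((wordLevel l : ℂ) + h) • ρ.word v l := by
  induction l with
  | nil => simp [word, wordLevel, hv]
  | cons k l ih =>
    rw [word, L_mem_eigenspace ρ _ ih]
    congr 1
    simp only [wordLevel, List.map_cons, List.sum_cons]
    push_cast
    ring

/-- The words in the raising operators applied to a singular vector span an invariant subspace. -/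
theorem isInvariant_span_word (ρ : VirasoroRep c V) {h : ℂ} {v : V} (hv : ρ.L 0 v = h • v)
    (hpos : ∀ n : ℤ, 0 < n → ρ.L n v = 0) :
    ρ.IsInvariant (Submodule.span ℂ (Set.range (ρ.word v))) := by
  set S := Submodule.span ℂ (Set.range (ρ.word v))
  have key : ∀ (l : List ℕ) (n : ℤ), ρ.L n (ρ.word v l) ∈ S := by
    have hword : ∀ l, ρ.word v l ∈ S := fun l => Submodule.subset_span ⟨l, rfl⟩
    have hneg : ∀ k : ℕ, ∀ x ∈ S, ρ.L (-((k : ℤ) + 1)) x ∈ S := by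
      intro k
      change S ≤ S.comap (ρ.L (-((k : ℤ) + 1)))
      rw [Submodule.span_le]
      rintro _ ⟨l, rfl⟩
      exact hword (k :: l)
    intro l
    induction l with
    | nil =>
      intro n
      obtain hn | rfl | hn := lt_trichotomy n 0
      · obtain ⟨k, rfl⟩ : ∃ k : ℕ, n = -((k : ℤ) + 1) := ⟨(-n - 1).toNat, by omega⟩
        exact hneg k _ (hword [])
      · rw [word, hv]
        exact S.smul_mem _ (hword [])
      · rw [word, hpos n hn]
        exact S.zero_mem
    | cons k l ih =>
      intro n
      rw [word, L_comm_apply]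
      exact S.add_mem (S.add_mem (hneg k _ (ih n)) (S.smul_mem _ (ih _)))
        (S.smul_mem _ (hword l))
  intro n
  change S ≤ S.comap (ρ.L n)
  rw [Submodule.span_le]
  rintro _ ⟨l, rfl⟩
  exact key l n

/-- If the image of a combination of words under a map intertwining `L 0` is an eigenvector, then
only the words of the corresponding level contribute to it. -/
theorem exists_mem_span_wordLevel (ρ : VirasoroRep c E) {h : ℂ} {v : E} (hv : ρ.L 0 v = h • v)
    (τ : Module.End ℂ V) (T : E →ₗ[ℂ] V) (hT : ∀ x, T (ρ.L 0 x) = τ (T x)) {x : E}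
    (hx : x ∈ Submodule.span ℂ (Set.range (ρ.word v))) (n : ℕ)
    (hTx : τ (T x) = ((n : ℂ) + h) • T x) :
    ∃ y ∈ Submodule.span ℂ (ρ.word v '' {l | wordLevel l = n}), T y = T x := by
  obtain ⟨a, rfl⟩ := Finsupp.mem_span_range_iff_exists_finsupp.1 hx
  set y := ∑ l ∈ a.support with wordLevel l = n, a l • ρ.word v l with hy
  set z := ∑ l ∈ a.support with ¬ wordLevel l = n, a l • ρ.word v l with hz
  have hsum : (a.sum fun l t => t • ρ.word v l) = y + z :=
    (Finset.sum_filter_add_sum_filter_not _ _ _).symm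
  rw [hsum] at hTx ⊢
  have hyS : y ∈ Submodule.span ℂ (ρ.word v '' {l | wordLevel l = n}) := by
    refine Submodule.sum_mem _ fun l hl =>
      Submodule.smul_mem _ _ (Submodule.subset_span ⟨l, ?_, rfl⟩)
    exact (Finset.mem_filter.1 hl).2
  have hword : ∀ l, T (ρ.word v l) ∈ τ.eigenspace ((wordLevel l : ℂ) + h) := by
    intro l
    rw [Module.End.mem_eigenspace_iff, ← hT, L_zero_word ρ hv, map_smul]
  have hTy : T y ∈ τ.eigenspace ((n : ℂ) + h) := by
    rw [hy, map_sum]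
    refine Submodule.sum_mem _ fun l hl => ?_
    rw [map_smul, ← (Finset.mem_filter.1 hl).2]
    exact Submodule.smul_mem _ _ (hword l)
  have hTz : T z ∈ τ.eigenspace ((n : ℂ) + h) := by
    have : T z = T (y + z) - T y := by rw [map_add, add_sub_cancel_left]
    rw [this]
    exact Submodule.sub_mem _ (Module.End.mem_eigenspace_iff.2 hTx) hTy
  have hTz' : T z ∈ ⨆ w ≠ ((n : ℂ) + h), τ.eigenspace w := by
    rw [hz, map_sum]
    refine Submodule.sum_mem _ fun l hl => ?_
    rw [map_smul]
    refine Submodule.smul_mem _ _ (Submodule.mem_iSup_of_mem _ (Submodule.mem_iSup_of_mem ?_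
      (hword l)))
    intro h'
    exact (Finset.mem_filter.1 hl).2 (by exact_mod_cast add_right_cancel h')
  have h0 := (Submodule.disjoint_def.1 (τ.eigenspaces_iSupIndep ((n : ℂ) + h))) _ hTz hTz'
  exact ⟨y, hyS, by rw [map_add, h0, add_zero]⟩

/-- The direct sum of two representations of the same central charge. -/
def prod (σ : VirasoroRep c E) (ρ : VirasoroRep c V) : VirasoroRep c (E × V) where
  L n := (σ.L n).prodMap (ρ.L n)
  comm m n := by
    refine LinearMap.ext fun x => Prod.ext ?_ ?_
    · exact congrArg (fun T : Module.End ℂ E => T x.1) (σ.comm m n)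
    · exact congrArg (fun T : Module.End ℂ V => T x.2) (ρ.comm m n)

theorem prod_L_apply (σ : VirasoroRep c E) (ρ : VirasoroRep c V) (n : ℤ) (x : E × V) :
    (σ.prod ρ).L n x = (σ.L n x.1, ρ.L n x.2) := rfl

/-- An irreducible lowest weight representation is a subquotient of any representation containing
a singular vector of the same weight: there is an invariant subspace `D` of the direct sum which is
the graph of a map onto `V`, and eigenvectors of `L 0` in `V` lift to eigenvectors. -/
theorem exists_invariant_graph (σ : VirasoroRep c E) (ρ : VirasoroRep c V) {h : ℂ} {e : E} {Ω : V}
    (he : e ≠ 0) (he0 : σ.L 0 e = h • e) (hpos : ∀ n : ℤ, 0 < n → σ.L n e = 0)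
    (hΩ : ρ.IsLowestWeightVector h Ω) (hirr : ρ.IsIrreducible) :
    ∃ D : Submodule ℂ (E × V), (σ.prod ρ).IsInvariant D ∧ (∀ v, ((0 : E), v) ∈ D → v = 0) ∧
      ∀ (n : ℕ) (Ψ : V), ρ.L 0 Ψ = ((n : ℂ) + h) • Ψ →
        ∃ f, σ.L 0 f = ((n : ℂ) + h) • f ∧ (f, Ψ) ∈ D := by
  set π := σ.prod ρ with hπ
  have hv0 : π.L 0 (e, Ω) = h • (e, Ω) := by
    rw [prod_L_apply, he0, hΩ.weight]; rfl
  have hvpos : ∀ n : ℤ, 0 < n → π.L n (e, Ω) = 0 := by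
    intro n hn
    rw [prod_L_apply, hpos n hn, hΩ.annihilated n hn]; rfl
  have hinv := isInvariant_span_word π hv0 hvpos
  have hmem : (e, Ω) ∈ Submodule.span ℂ (Set.range (π.word (e, Ω))) :=
    Submodule.subset_span ⟨[], rfl⟩
  set D := Submodule.span ℂ (Set.range (π.word (e, Ω)))
  refine ⟨D, hinv, ?_, ?_⟩
  · have hK : ρ.IsInvariant (D.comap (LinearMap.inr ℂ E V)) := by
      intro n v hv
      have := hinv n _ hv
      rw [prod_L_apply] at this
      simpa using this
    rcases hirr.2 _ hK with hbot | htop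
    · intro v hv
      have : v ∈ D.comap (LinearMap.inr ℂ E V) := hv
      rwa [hbot, Submodule.mem_bot] at this
    · -- otherwise `(0, Ω)` would be in `D`, but the only vectors of weight `h` there are the
      -- multiples of `(e, Ω)`
      exfalso
      have hΩD : ((0 : E), Ω) ∈ D := by
        have : Ω ∈ D.comap (LinearMap.inr ℂ E V) := htop ▸ Submodule.mem_top
        exact this
      obtain ⟨y, hy, hyx⟩ := exists_mem_span_wordLevel π hv0 (π.L 0) LinearMap.id (fun _ => rfl)
        hΩD 0 (by
          rw [LinearMap.id_apply, prod_L_apply, map_zero, hΩ.weight]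
          simp)
      have hlevel : {l | wordLevel l = 0} = {[]} := by
        ext l
        cases l with
        | nil => simp [wordLevel]
        | cons k l => simp [wordLevel]
      rw [hlevel, Set.image_singleton, Submodule.mem_span_singleton] at hy
      obtain ⟨t, rfl⟩ := hy
      rw [LinearMap.id_apply, LinearMap.id_apply, word, Prod.smul_mk, Prod.mk.injEq] at hyx
      rcases smul_eq_zero.1 hyx.1 with ht | h'
      · refine hΩ.ne_zero ?_
        rw [← hyx.2, ht, zero_smul]
      · exact he h'
  · intro n Ψ hΨ
    have htop : D.map (LinearMap.snd ℂ E V) = ⊤ := by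
      refine hΩ.cyclic _ ?_ ⟨_, hmem, rfl⟩
      rintro m _ ⟨x, hx, rfl⟩
      exact ⟨_, hinv m x hx, rfl⟩
    obtain ⟨x, hx, hxΨ⟩ : Ψ ∈ D.map (LinearMap.snd ℂ E V) := htop ▸ Submodule.mem_top
    obtain ⟨y, hy, hyx⟩ := exists_mem_span_wordLevel π hv0 (ρ.L 0) (LinearMap.snd ℂ E V)
      (fun _ => rfl) hx n (by rw [hxΨ, hΨ])
    have hyD : y ∈ D := Submodule.span_mono (Set.image_subset_range _ _) hy
    have hyeig : π.L 0 y = ((n : ℂ) + h) • y := by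
      rw [← Module.End.mem_eigenspace_iff]
      refine Submodule.span_le.2 ?_ hy
      rintro _ ⟨l, hl, rfl⟩
      rw [SetLike.mem_coe, Module.End.mem_eigenspace_iff, L_zero_word π hv0, hl]
    refine ⟨y.1, ?_, ?_⟩
    · exact congrArg Prod.fst hyeig
    · rw [← hxΨ, ← hyx]
      exact hyD

/-- An eigenvalue of `∑ L (-k) L k` on a weight space of an irreducible lowest weight representation
also occurs on the corresponding weight space of any representation with a singular vector of the
same weight `h`, if that weight space is finite-dimensional. If it did not occur there, the operator
`∑ L (-k) L k - lam` would be invertible on the kernel of the map onto `V`, and a lift of `Ψ` would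
lie in this kernel. -/
theorem exists_sumLL_eigenvector (σ : VirasoroRep c E) (ρ : VirasoroRep c V) {h : ℂ} {e : E}
    (he : e ≠ 0) (he0 : σ.L 0 e = h • e) (hpos : ∀ n : ℤ, 0 < n → σ.L n e = 0)
    (hlow : ρ.IsLowestWeightRep h) (hirr : ρ.IsIrreducible) (n : ℕ)
    [FiniteDimensional ℂ ((σ.L 0).eigenspace ((n : ℂ) + h))]
    (hzero : ∀ f, σ.L 0 f = ((n : ℂ) + h) • f → ∀ k : ℤ, n < k → σ.L k f = 0)
    {Ψ : V} (hΨ : Ψ ≠ 0) {lam : ℂ} (hL : ρ.L 0 Ψ = ((n : ℂ) + h) • Ψ)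
    (hsum : ρ.sumLL Ψ = lam • Ψ) :
    ∃ f ≠ 0, σ.L 0 f = ((n : ℂ) + h) • f ∧
      ∑ k ∈ Finset.range (n + 1), σ.L (-(k : ℤ)) (σ.L k f) = lam • f := by
  obtain ⟨Ω, hΩ⟩ := hlow
  obtain ⟨D, hinv, hgraph, hlift⟩ := exists_invariant_graph σ ρ he he0 hpos hΩ hirr
  by_contra! hno
  obtain ⟨f, hf, hfD⟩ := hlift n Ψ hL
  have hΨzero : ∀ k : ℤ, n < k → ρ.L k Ψ = 0 := by
    intro k hk
    refine hgraph _ ?_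
    have := hinv k _ hfD
    rwa [prod_L_apply, hzero f hf k hk] at this
  let A : Module.End ℂ E := ∑ k ∈ Finset.range (n + 1), σ.L (-(k : ℤ)) * σ.L k
  have hA : ∀ f, A f = ∑ k ∈ Finset.range (n + 1), σ.L (-(k : ℤ)) (σ.L k f) := fun f => by
    simp [A, LinearMap.sum_apply]
  have hAΨ : ∑ k ∈ Finset.range (n + 1), ρ.L (-(k : ℤ)) (ρ.L k Ψ) = lam • Ψ := by
    rw [← hsum, sumLL, finsum_eq_sum_of_support_subset]
    intro k hk
    rw [Finset.mem_coe, Finset.mem_range]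
    by_contra hk'
    exact hk (by simp only [hΨzero k (by omega), map_zero])
  have hAD : ∀ x ∈ D, (A x.1, ∑ k ∈ Finset.range (n + 1), ρ.L (-(k : ℤ)) (ρ.L k x.2)) ∈ D := by
    intro x hx
    have : (A x.1, ∑ k ∈ Finset.range (n + 1), ρ.L (-(k : ℤ)) (ρ.L k x.2)) =
        ∑ k ∈ Finset.range (n + 1), (σ.prod ρ).L (-(k : ℤ)) ((σ.prod ρ).L k x) := by
      rw [hA]
      exact Prod.ext (by simp [Prod.fst_sum, prod_L_apply]) (by simp [Prod.snd_sum, prod_L_apply])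
    rw [this]
    exact Submodule.sum_mem _ fun k _ => hinv _ _ (hinv _ _ hx)
  have hAeig : ∀ g, σ.L 0 g = ((n : ℂ) + h) • g → σ.L 0 (A g) = ((n : ℂ) + h) • A g := by
    intro g hg
    rw [hA, map_sum, Finset.smul_sum]
    refine Finset.sum_congr rfl fun k _ => ?_
    rw [L_mem_eigenspace σ _ (L_mem_eigenspace σ _ hg)]
    congr 1
    push_cast
    ring
  -- the kernel, in the weight space, of the map whose graph is `D`
  let K : Submodule ℂ E := (σ.L 0).eigenspace ((n : ℂ) + h) ⊓ D.comap (LinearMap.inl ℂ E V)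
  have hmemK : ∀ g, g ∈ K ↔ σ.L 0 g = ((n : ℂ) + h) • g ∧ (g, (0 : V)) ∈ D := fun g => by
    simp [K]
  have : FiniteDimensional ℂ K := Submodule.finiteDimensional_of_le inf_le_left
  let B : Module.End ℂ E := A - lam • 1
  have hB : ∀ g, B g = A g - lam • g := fun g => rfl
  have hBK : ∀ g ∈ K, B g ∈ K := by
    intro g hg
    rw [hmemK] at hg ⊢
    have h2 := D.sub_mem (hAD _ hg.2) (D.smul_mem lam hg.2)
    refine ⟨?_, by simpa [hB] using h2⟩
    rw [hB, map_sub, hAeig g hg.1, map_smul, hg.1]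
    module
  have hBinj : ∀ g, σ.L 0 g = ((n : ℂ) + h) • g → B g = 0 → g = 0 := by
    intro g hg hg0
    by_contra hne
    rw [hB, sub_eq_zero, hA] at hg0
    exact hno g hne hg hg0
  have hBsurj : Function.Surjective (B.restrict hBK) := by
    refine LinearMap.injective_iff_surjective.1 ((injective_iff_map_eq_zero _).2 fun g hg => ?_)
    exact Subtype.ext (hBinj g ((hmemK g).1 g.2).1 (congrArg Subtype.val hg))
  have hBf : B f ∈ K := by
    rw [hmemK]
    have h2 := D.sub_mem (hAD _ hfD) (D.smul_mem lam hfD)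
    refine ⟨?_, by simpa [hB, hAΨ] using h2⟩
    rw [hB, map_sub, hAeig f hf, map_smul, hf]
    module
  obtain ⟨⟨g, hgK⟩, hg⟩ := hBsurj ⟨B f, hBf⟩
  have hg' : B g = B f := congrArg Subtype.val hg
  rw [hmemK] at hgK
  have hfg : f - g = 0 := by
    refine hBinj _ ?_ (by rw [map_sub, hg', sub_self])
    rw [map_sub, hf, hgK.1, smul_sub]
  refine hΨ (hgraph Ψ ?_)
  have := D.sub_mem hfD hgK.2
  rwa [Prod.mk_sub_mk, hfg, sub_zero] at this

end VirasoroRep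

/-! ### The coefficient norm and the level -/

namespace Fock

open MvPolynomial

/-- The sum of the absolute values of the coefficients of a polynomial. -/
noncomputable def coeffNorm (f : MvPolynomial ℕ ℂ) : ℝ := ∑ d ∈ f.support, ‖coeff d f‖

theorem coeffNorm_eq_sum {f : MvPolynomial ℕ ℂ} {s : Finset (ℕ →₀ ℕ)} (hs : f.support ⊆ s) :
    coeffNorm f = ∑ d ∈ s, ‖coeff d f‖ :=
  Finset.sum_subset hs fun d _ hd => by rw [notMem_support_iff.1 hd, norm_zero]

theorem coeffNorm_zero : coeffNorm 0 = 0 := by simp [coeffNorm]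

theorem coeffNorm_pos {f : MvPolynomial ℕ ℂ} (hf : f ≠ 0) : 0 < coeffNorm f :=
  Finset.sum_pos (fun _ hd => norm_pos_iff.2 (mem_support_iff.1 hd)) (support_nonempty.2 hf)

theorem coeffNorm_add_le (f g : MvPolynomial ℕ ℂ) :
    coeffNorm (f + g) ≤ coeffNorm f + coeffNorm g := by
  classical
  rw [coeffNorm_eq_sum (support_add (p := f) (q := g)),
    coeffNorm_eq_sum (f := f) (s := f.support ∪ g.support) Finset.subset_union_left,
    coeffNorm_eq_sum (f := g) (s := f.support ∪ g.support) Finset.subset_union_right,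
    ← Finset.sum_add_distrib]
  exact Finset.sum_le_sum fun d _ => by rw [coeff_add]; exact norm_add_le _ _

theorem coeffNorm_smul (z : ℂ) (f : MvPolynomial ℕ ℂ) :
    coeffNorm (z • f) = ‖z‖ * coeffNorm f := by
  rw [coeffNorm_eq_sum (support_smul (a := z) (f := f)), coeffNorm, Finset.mul_sum]
  exact Finset.sum_congr rfl fun d _ => by rw [coeff_smul, smul_eq_mul, norm_mul]

theorem coeffNorm_sum_le {ι : Type*} (s : Finset ι) (g : ι → MvPolynomial ℕ ℂ) :
    coeffNorm (∑ i ∈ s, g i) ≤ ∑ i ∈ s, coeffNorm (g i) :=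
  Finset.le_sum_of_subadditive _ coeffNorm_zero.le coeffNorm_add_le s g

theorem coeffNorm_monomial (d : ℕ →₀ ℕ) (z : ℂ) : coeffNorm (monomial d z) = ‖z‖ := by
  rw [coeffNorm_eq_sum support_monomial_subset, Finset.sum_singleton, coeff_monomial, if_pos rfl]

/-- A linear map which is bounded on the monomials in the support of `f` is bounded at `f`. -/
theorem coeffNorm_apply_le {T : Module.End ℂ (MvPolynomial ℕ ℂ)} {f : MvPolynomial ℕ ℂ} {C : ℝ}
    (hT : ∀ d ∈ f.support, coeffNorm (T (monomial d 1)) ≤ C) :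
    coeffNorm (T f) ≤ C * coeffNorm f := by
  have h1 : T f = ∑ d ∈ f.support, coeff d f • T (monomial d 1) := by
    conv_lhs => rw [as_sum f]
    rw [map_sum]
    refine Finset.sum_congr rfl fun d _ => ?_
    rw [← map_smul, smul_monomial, smul_eq_mul, mul_one]
  rw [h1, show coeffNorm f = ∑ d ∈ f.support, ‖coeff d f‖ from rfl, Finset.mul_sum]
  refine (coeffNorm_sum_le _ _).trans (Finset.sum_le_sum fun d hd => ?_)
  rw [coeffNorm_smul, mul_comm]
  exact mul_le_mul_of_nonneg_right (hT d hd) (norm_nonneg _)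

/-- The level of a monomial: the variable `X i` has level `i + 1`. -/
noncomputable def level : (ℕ →₀ ℕ) →+ ℕ := Finsupp.weight fun i : ℕ => i + 1

theorem sum_range_le_level (d : ℕ →₀ ℕ) (M : ℕ) :
    ∑ j ∈ Finset.range M, ((j : ℝ) + 1) * d j ≤ level d := by
  have h : ∑ j ∈ Finset.range M, (j + 1) * d j ≤ level d := by
    rw [level, Finsupp.weight_apply, Finsupp.sum]
    simp only [smul_eq_mul, mul_comm (d _)]
    refine Finset.sum_le_sum_of_ne_zero fun j _ hj => ?_
    rw [Finsupp.mem_support_iff]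
    rintro h
    exact hj (by rw [h, mul_zero])
  exact_mod_cast h

theorem succ_le_level {d : ℕ →₀ ℕ} {i : ℕ} (hi : d i ≠ 0) : i + 1 ≤ level d :=
  Finsupp.le_weight_of_ne_zero' (fun i : ℕ => i + 1) hi

theorem finite_level_eq (n : ℕ) : {d : ℕ →₀ ℕ | level d = n}.Finite := by
  refine Set.Finite.subset
    (Finset.finite_toSet (Finset.finsupp (Finset.range n) fun _ => Finset.range (n + 1))) ?_
  rintro d rfl
  rw [Finset.mem_coe, Finset.mem_finsupp_iff]
  refine ⟨fun i hi => ?_, fun i _ => ?_⟩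
  · have := succ_le_level (Finsupp.mem_support_iff.1 hi)
    exact Finset.mem_range.2 (by omega)
  · have := Finsupp.le_weight (fun i : ℕ => i + 1) (s := i) (by omega) d
    exact Finset.mem_range.2 (Nat.lt_succ_of_le this)

/-! ### Weight spaces of the Fock representation -/

variable (μ γ : ℂ)

theorem vir_zero_monomial (d : ℕ →₀ ℕ) :
    vir μ γ 0 (monomial d 1) = ((level d : ℂ) + weight μ γ) • monomial d 1 := by
  have hX : ∀ (i : ℕ) (f : MvPolynomial ℕ ℂ),
      vir μ γ 0 (X i * f) = X i * vir μ γ 0 f + ((i : ℂ) + 1) • (X i * f) := by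
    intro i f
    have h := vir_mode μ γ 0 (-((i : ℤ) + 1)) f
    rw [zero_add, if_neg (by omega), mode_neg_apply, mode_neg_apply] at h
    rw [h]
    push_cast
    module
  have key : ∀ f, vir μ γ 0 (monomial d 1 * f) =
      monomial d 1 * vir μ γ 0 f + (level d : ℂ) • (monomial d 1 * f) := by
    induction d using Finsupp.induction_linear with
    | zero => intro f; simp
    | add d e hd he =>
      intro f
      have : (monomial (d + e) 1 : MvPolynomial ℕ ℂ) = monomial d 1 * monomial e 1 := by
        rw [monomial_mul, mul_one]
      rw [this, mul_assoc, hd, he, map_add, mul_add, mul_smul_comm]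
      push_cast
      rw [mul_assoc]
      module
    | single i m =>
      induction m with
      | zero => intro f; simp
      | succ m ih =>
        intro f
        have : (monomial (Finsupp.single i (m + 1)) 1 : MvPolynomial ℕ ℂ) =
            X i * monomial (Finsupp.single i m) 1 := by
          rw [X, monomial_mul, mul_one, ← Finsupp.single_add, add_comm]
        rw [this, mul_assoc, hX, ih, mul_add, mul_smul_comm, Finsupp.single_add, map_add]
        have h1 : level (Finsupp.single i 1) = i + 1 := by
          simp [level, Finsupp.weight_apply]
        rw [h1]
        push_cast
        rw [mul_assoc]
        module
  have := key 1
  rw [mul_one, vir_zero_one, mul_smul_comm, mul_one] at this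
  rw [this]
  module

theorem coeff_vir_zero (f : MvPolynomial ℕ ℂ) (d : ℕ →₀ ℕ) :
    coeff d (vir μ γ 0 f) = ((level d : ℂ) + weight μ γ) * coeff d f := by
  induction f using MvPolynomial.induction_on' with
  | monomial e z =>
    have : (monomial e z : MvPolynomial ℕ ℂ) = z • monomial e 1 := by
      rw [smul_monomial, smul_eq_mul, mul_one]
    rw [this, map_smul, vir_zero_monomial, coeff_smul, coeff_smul, coeff_smul, coeff_monomial]
    split_ifs with h
    · rw [h]; simp only [smul_eq_mul]; ring
    · simp
  | add p q hp hq => rw [map_add, coeff_add, hp, hq, coeff_add, mul_add]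

theorem level_eq_of_mem_support {f : MvPolynomial ℕ ℂ} {z : ℂ}
    (hf : vir μ γ 0 f = (z + weight μ γ) • f) {d : ℕ →₀ ℕ} (hd : d ∈ f.support) :
    (level d : ℂ) = z := by
  have h := coeff_vir_zero μ γ f d
  rw [hf, coeff_smul, smul_eq_mul] at h
  exact add_right_cancel (mul_right_cancel₀ (mem_support_iff.1 hd) h).symm

theorem finiteDimensional_eigenspace (n : ℕ) :
    FiniteDimensional ℂ ((vir μ γ 0).eigenspace ((n : ℂ) + weight μ γ)) := by
  have hfin := (finite_level_eq n).image fun d => (monomial d 1 : MvPolynomial ℕ ℂ)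
  have := FiniteDimensional.span_of_finite ℂ hfin
  refine Submodule.finiteDimensional_of_le (S₂ := Submodule.span ℂ
    ((fun d => (monomial d 1 : MvPolynomial ℕ ℂ)) '' {d | level d = n})) (fun f hf => ?_)
  rw [as_sum f]
  refine Submodule.sum_mem _ fun d hd => ?_
  have hm : (monomial d (coeff d f) : MvPolynomial ℕ ℂ) = coeff d f • monomial d 1 := by
    rw [smul_monomial, smul_eq_mul, mul_one]
  rw [hm]
  refine Submodule.smul_mem _ _ (Submodule.subset_span ⟨d, ?_, rfl⟩)
  have := level_eq_of_mem_support μ γ (Module.End.mem_eigenspace_iff.1 hf) hd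
  exact_mod_cast this

theorem vir_zero_vir_of_eigen {f : MvPolynomial ℕ ℂ} {z : ℂ}
    (hf : vir μ γ 0 f = (z + weight μ γ) • f) (k : ℤ) :
    vir μ γ 0 (vir μ γ k f) = (z - k + weight μ γ) • vir μ γ k f := by
  rw [vir_zero_vir, hf, map_smul]
  module

theorem vir_eq_zero_of_lt {f : MvPolynomial ℕ ℂ} {n : ℕ}
    (hf : vir μ γ 0 f = ((n : ℂ) + weight μ γ) • f) (k : ℤ) (hk : n < k) : vir μ γ k f = 0 := by
  by_contra h
  obtain ⟨d, hd⟩ := support_nonempty.2 h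
  have := level_eq_of_mem_support μ γ (vir_zero_vir_of_eigen μ γ hf k) hd
  have h2 : (level d : ℤ) = n - k := by exact_mod_cast this
  omega

/-! ### Norm estimates for the Virasoro operators -/

/-- The norm of the mode `a z` on the monomial with exponents `d`. -/
noncomputable def modeBound (d : ℕ →₀ ℕ) : ℤ → ℝ
  | .ofNat 0 => ‖μ‖
  | .ofNat (k + 1) => ((k : ℝ) + 1) * d k
  | .negSucc _ => 1

theorem modeBound_zero (d : ℕ →₀ ℕ) : modeBound μ d 0 = ‖μ‖ := rfl

theorem modeBound_pos (d : ℕ →₀ ℕ) (k : ℕ) :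
    modeBound μ d ((k : ℤ) + 1) = ((k : ℝ) + 1) * d k := rfl

theorem modeBound_neg (d : ℕ →₀ ℕ) {z : ℤ} (hz : z < 0) : modeBound μ d z = 1 := by
  obtain rfl | ⟨i, rfl⟩ | ⟨i, rfl⟩ := int_cases z
  · omega
  · omega
  · rw [show -((i : ℤ) + 1) = Int.negSucc i from rfl]
    rfl

theorem modeBound_nonneg (d : ℕ →₀ ℕ) (z : ℤ) : 0 ≤ modeBound μ d z := by
  obtain rfl | ⟨i, rfl⟩ | ⟨i, rfl⟩ := int_cases z
  · exact norm_nonneg _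
  · rw [modeBound_pos]; positivity
  · rw [modeBound_neg μ d (by omega)]; exact zero_le_one

theorem modeBound_eq_of_nonpos (d e : ℕ →₀ ℕ) {z : ℤ} (hz : z ≤ 0) :
    modeBound μ d z = modeBound μ e z := by
  obtain rfl | h := hz.eq_or_lt
  · rfl
  · rw [modeBound_neg μ d h, modeBound_neg μ e h]

theorem modeBound_mono {d e : ℕ →₀ ℕ} (hde : d ≤ e) (z : ℤ) :
    modeBound μ d z ≤ modeBound μ e z := by
  obtain h | h := le_or_gt z 0
  · exact (modeBound_eq_of_nonpos μ d e h).le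
  · obtain ⟨k, rfl⟩ : ∃ k : ℕ, z = k + 1 := ⟨(z - 1).toNat, by omega⟩
    rw [modeBound_pos, modeBound_pos]
    have : (d k : ℝ) ≤ e k := by exact_mod_cast hde k
    gcongr

theorem exists_mode_monomial (d : ℕ →₀ ℕ) (z : ℤ) (w : ℂ) :
    ∃ e t, fockMode μ z (monomial d w) = monomial e t ∧ ‖t‖ = modeBound μ d z * ‖w‖ ∧
      (0 < z → e ≤ d) := by
  obtain rfl | ⟨i, rfl⟩ | ⟨i, rfl⟩ := int_cases z
  · refine ⟨d, μ * w, ?_, by rw [norm_mul, modeBound_zero], fun h => le_rfl⟩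
    rw [mode_zero_apply, smul_monomial, smul_eq_mul]
  · refine ⟨d - Finsupp.single i 1, ((i : ℂ) + 1) * (w * d i), ?_, ?_, fun _ => tsub_le_self⟩
    · rw [mode_pos_apply, pderiv_monomial, smul_monomial, smul_eq_mul]
    · rw [modeBound_pos, norm_mul, norm_mul, Complex.norm_natCast,
        show (i : ℂ) + 1 = ((i + 1 : ℕ) : ℂ) by push_cast; rfl, Complex.norm_natCast]
      push_cast
      ring
  · refine ⟨Finsupp.single i 1 + d, w, ?_, ?_, fun h => by omega⟩
    · rw [mode_neg_apply, X, monomial_mul, one_mul]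
    · rw [modeBound_neg μ d (by omega), one_mul]

theorem coeffNorm_mode_le (d : ℕ →₀ ℕ) (z : ℤ) :
    coeffNorm (fockMode μ z (monomial d 1)) ≤ modeBound μ d z := by
  obtain ⟨e, t, h1, h2, -⟩ := exists_mode_monomial μ d z 1
  rw [h1, coeffNorm_monomial, h2, norm_one, mul_one]

theorem coeffNorm_mode_mode_le (d : ℕ →₀ ℕ) {y z : ℤ} (h : 0 < z ∨ y ≤ 0) :
    coeffNorm (fockMode μ y (fockMode μ z (monomial d 1))) ≤
      modeBound μ d y * modeBound μ d z := by
  obtain ⟨e, t, h1, h2, h3⟩ := exists_mode_monomial μ d z 1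
  obtain ⟨e', t', h1', h2', -⟩ := exists_mode_monomial μ e y t
  rw [h1, h1', coeffNorm_monomial, h2', h2, norm_one, mul_one]
  refine mul_le_mul_of_nonneg_right ?_ (modeBound_nonneg _ _ _)
  rcases h with h | h
  · exact modeBound_mono μ (h3 h) y
  · exact (modeBound_eq_of_nonpos μ e d h).le

theorem eventually_coeffNorm_vir_le (d : ℕ →₀ ℕ) {n : ℤ} (hn : n ≠ 0) :
    ∃ N : ℕ, ∀ M, N ≤ M → coeffNorm (vir μ γ n (monomial d 1)) ≤
      1 / 2 * ∑ j ∈ Finset.range M, modeBound μ d (n - (j + 1)) * modeBound μ d (j + 1) +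
      1 / 2 * ∑ j ∈ Finset.range M, modeBound μ d (-j) * modeBound μ d (n + j) +
      ‖γ‖ * |(n : ℝ)| * modeBound μ d n := by
  obtain ⟨N, hN⟩ := (heisenberg μ).eventually_sugawara_eq γ n (monomial d 1)
  refine ⟨N, fun M hM => ?_⟩
  rw [hN M hM]
  simp only [HeisenbergRep.sugawaraTrunc, heisenberg, LinearMap.add_apply, LinearMap.smul_apply,
    LinearMap.sum_apply, Module.End.mul_apply, if_neg hn, zero_smul, add_zero]
  refine (coeffNorm_add_le _ _).trans (add_le_add ((coeffNorm_add_le _ _).trans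
    (add_le_add ?_ ?_)) ?_)
  · rw [coeffNorm_smul, show ‖(1 / 2 : ℂ)‖ = 1 / 2 by norm_num]
    refine mul_le_mul_of_nonneg_left ((coeffNorm_sum_le _ _).trans
      (Finset.sum_le_sum fun j _ => ?_)) (by norm_num)
    exact coeffNorm_mode_mode_le μ d (Or.inl (by omega))
  · rw [coeffNorm_smul, show ‖(1 / 2 : ℂ)‖ = 1 / 2 by norm_num]
    refine mul_le_mul_of_nonneg_left ((coeffNorm_sum_le _ _).trans
      (Finset.sum_le_sum fun j _ => ?_)) (by norm_num)
    exact coeffNorm_mode_mode_le μ d (Or.inr (by omega))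
  · rw [coeffNorm_smul, norm_mul, Complex.norm_intCast]
    exact mul_le_mul_of_nonneg_left (coeffNorm_mode_le μ d n) (by positivity)

theorem sum_modeBound_sub_le (d : ℕ →₀ ℕ) (i M : ℕ) :
    ∑ j ∈ Finset.range M, modeBound μ d ((j : ℤ) - i) ≤ i + ‖μ‖ + level d := by
  induction i generalizing M with
  | zero =>
    cases M with
    | zero => simp; positivity
    | succ M =>
      rw [Finset.sum_range_succ']
      have := sum_range_le_level d M
      simp only [Nat.cast_zero, sub_zero, Nat.cast_add, Nat.cast_one, modeBound_pos, modeBound_zero]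
      linarith
  | succ i ih =>
    cases M with
    | zero => simp; positivity
    | succ M =>
      rw [Finset.sum_range_succ', modeBound_neg μ d (by omega)]
      have h := ih M
      have h2 : ∀ j : ℕ, ((j + 1 : ℕ) : ℤ) - ((i + 1 : ℕ) : ℤ) = (j : ℤ) - i := by intro j; omega
      simp only [h2]
      push_cast
      linarith

/-- The terms of `L (-k)` which modify a letter of the monomial contribute the level, those which
create two letters contribute at most `k / 2`, and those with `a 0` contribute `‖μ‖`. -/
theorem coeffNorm_vir_neg_le (d : ℕ →₀ ℕ) (k : ℕ) (hk : 0 < k) :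
    coeffNorm (vir μ γ (-k) (monomial d 1)) ≤ level d + k / 2 + ‖μ‖ + ‖γ‖ * k := by
  obtain ⟨M, hM⟩ := eventually_coeffNorm_vir_le μ γ d (n := -k) (by omega)
  refine (hM _ (Nat.le_succ M)).trans ?_
  have h1 : ∑ j ∈ Finset.range (M + 1), modeBound μ d (-k - (j + 1)) * modeBound μ d (j + 1) ≤
      level d := by
    refine le_trans (Finset.sum_le_sum fun j _ => ?_) (sum_range_le_level d (M + 1))
    rw [modeBound_neg μ d (by omega), one_mul, modeBound_pos]
  have h2 : ∑ j ∈ Finset.range (M + 1), modeBound μ d (-j) * modeBound μ d (-k + j) ≤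
      ‖μ‖ + (k + ‖μ‖ + level d) := by
    rw [Finset.sum_range_succ']
    have h3 := sum_modeBound_sub_le μ d k (M + 1)
    rw [Finset.sum_range_succ', modeBound_neg μ d (z := ((0 : ℕ) : ℤ) - k) (by omega)] at h3
    have h4 : ∑ j ∈ Finset.range M, modeBound μ d (-((j + 1 : ℕ) : ℤ)) *
        modeBound μ d (-k + ((j + 1 : ℕ) : ℤ)) =
        ∑ j ∈ Finset.range M, modeBound μ d (((j + 1 : ℕ) : ℤ) - k) := by
      refine Finset.sum_congr rfl fun j _ => ?_
      rw [modeBound_neg μ d (by omega), one_mul, neg_add_eq_sub]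
    rw [h4, modeBound_neg μ d (z := -k + ((0 : ℕ) : ℤ)) (by omega)]
    simp only [Nat.cast_zero, neg_zero, modeBound_zero, mul_one]
    linarith
  rw [modeBound_neg μ d (by omega)]
  push_cast
  rw [abs_neg, Nat.abs_cast]
  linarith

theorem mul_le_level_mul (d : ℕ →₀ ℕ) (j : ℕ) :
    ((j : ℝ) + 1) * (((j : ℝ) + 1) * d j) ≤ level d * (((j : ℝ) + 1) * d j) := by
  by_cases h : d j = 0
  · simp [h]
  · have : ((j : ℝ) + 1) ≤ level d := by exact_mod_cast succ_le_level h
    gcongr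

/-- Summing over the lowering operators, the quadratic terms are controlled by the square of the
level, since the letters of a monomial add up to its level. -/
theorem sum_coeffNorm_vir_le (d : ℕ →₀ ℕ) :
    ∑ i ∈ Finset.range (level d), coeffNorm (vir μ γ ((i : ℤ) + 1) (monomial d 1)) ≤
      level d * (3 / 2 * level d + ‖μ‖ + ‖γ‖ * level d) := by
  set n := level d with hn
  have hN : ∀ i : ℕ, ∃ N : ℕ, ∀ M, N ≤ M → _ := fun i =>
    eventually_coeffNorm_vir_le μ γ d (n := (i : ℤ) + 1) (by omega)
  choose N hN using hN
  obtain ⟨M, hM⟩ : ∃ M, ∀ i ∈ Finset.range n, N i ≤ M :=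
    ⟨_, fun i hi => Finset.le_sup (f := N) hi⟩
  refine (Finset.sum_le_sum fun i hi => hN i M (hM i hi)).trans ?_
  rw [Finset.sum_add_distrib, Finset.sum_add_distrib, ← Finset.mul_sum, ← Finset.mul_sum]
  have h1 : ∑ i ∈ Finset.range n, ∑ j ∈ Finset.range M,
      modeBound μ d ((i : ℤ) + 1 - (j + 1)) * modeBound μ d (j + 1) ≤ (2 * n + ‖μ‖) * n := by
    rw [Finset.sum_comm]
    refine le_trans (Finset.sum_le_sum
      (g := fun j : ℕ => (2 * (n : ℝ) + ‖μ‖) * (((j : ℝ) + 1) * d j)) fun j _ => ?_) ?_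
    · rw [← Finset.sum_mul, modeBound_pos]
      have h := sum_modeBound_sub_le μ d j n
      simp only [add_sub_add_right_eq_sub]
      have h2 := mul_le_level_mul d j
      have h3 : 0 ≤ ((j : ℝ) + 1) * d j := by positivity
      have h4 := mul_le_mul_of_nonneg_right h h3
      rw [← hn] at h2 h4
      linarith
    · rw [← Finset.mul_sum]
      exact mul_le_mul_of_nonneg_left (sum_range_le_level d M) (by positivity)
  have h2 : ∑ i ∈ Finset.range n, ∑ j ∈ Finset.range M,
      modeBound μ d (-j) * modeBound μ d ((i : ℤ) + 1 + j) ≤ ‖μ‖ * n + n * n := by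
    have h3 : ∀ i : ℕ, ∑ j ∈ Finset.range M,
        modeBound μ d (-j) * modeBound μ d ((i : ℤ) + 1 + j) ≤
        ‖μ‖ * (((i : ℝ) + 1) * d i) + n := by
      intro i
      have h4 := sum_range_le_level d (i + M)
      rw [Finset.sum_range_add] at h4
      have h5 : 0 ≤ ∑ j ∈ Finset.range i, ((j : ℝ) + 1) * d j :=
        Finset.sum_nonneg fun _ _ => by positivity
      have h6 : ∀ j : ℕ, modeBound μ d (-j) * modeBound μ d ((i : ℤ) + 1 + j) ≤
          (if j = 0 then ‖μ‖ * (((i : ℝ) + 1) * d i) else 0) +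
            (((i + j : ℕ) : ℝ) + 1) * d (i + j) := by
        intro j
        have h7 : modeBound μ d ((i : ℤ) + 1 + j) = (((i + j : ℕ) : ℝ) + 1) * d (i + j) := by
          rw [← modeBound_pos μ]
          congr 1
          push_cast
          ring
        rw [h7]
        obtain rfl | hj := Nat.eq_zero_or_pos j
        · simp only [Nat.cast_zero, neg_zero, modeBound_zero, add_zero, if_true]
          have : 0 ≤ ((i : ℝ) + 1) * d i := by positivity
          linarith
        · rw [modeBound_neg μ d (by omega), if_neg hj.ne', one_mul, zero_add]
      refine (Finset.sum_le_sum fun j _ => h6 j).trans ?_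
      rw [Finset.sum_add_distrib, Finset.sum_ite_eq']
      have h8 : 0 ≤ ‖μ‖ * (((i : ℝ) + 1) * d i) := by positivity
      split_ifs <;> linarith
    refine (Finset.sum_le_sum fun i _ => h3 i).trans ?_
    rw [Finset.sum_add_distrib, ← Finset.mul_sum, Finset.sum_const, Finset.card_range,
      nsmul_eq_mul]
    exact add_le_add_left (mul_le_mul_of_nonneg_left (sum_range_le_level d n) (norm_nonneg _)) _
  have h3 : ∑ i ∈ Finset.range n, ‖γ‖ * |(((i : ℤ) + 1 : ℤ) : ℝ)| * modeBound μ d ((i : ℤ) + 1) ≤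
      ‖γ‖ * (n * n) := by
    have h4 : ∀ i : ℕ, ‖γ‖ * |(((i : ℤ) + 1 : ℤ) : ℝ)| * modeBound μ d ((i : ℤ) + 1) ≤
        ‖γ‖ * (n * (((i : ℝ) + 1) * d i)) := by
      intro i
      rw [modeBound_pos, mul_assoc]
      push_cast
      rw [abs_of_nonneg (by positivity)]
      exact mul_le_mul_of_nonneg_left (mul_le_level_mul d i) (norm_nonneg _)
    refine (Finset.sum_le_sum fun i _ => h4 i).trans ?_
    rw [← Finset.mul_sum, ← Finset.mul_sum]
    have := sum_range_le_level d n
    gcongr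
  linarith

/-- The norm of `∑ L (-k) L k` on the vectors of level `n` of the Fock space. -/
theorem norm_eigenvalue_le {n : ℕ} {f : MvPolynomial ℕ ℂ} (hf0 : f ≠ 0)
    (hf : vir μ γ 0 f = ((n : ℂ) + weight μ γ) • f) {lam : ℂ}
    (hlam : ∑ k ∈ Finset.range (n + 1), vir μ γ (-(k : ℤ)) (vir μ γ k f) = lam • f) :
    ‖lam‖ ≤ ‖(n : ℂ) + weight μ γ‖ ^ 2 +
      (n + ‖μ‖ + ‖γ‖ * n) * (n * (3 / 2 * n + ‖μ‖ + ‖γ‖ * n)) := by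
  let A : Module.End ℂ (MvPolynomial ℕ ℂ) :=
    ∑ k ∈ Finset.range (n + 1), vir μ γ (-(k : ℤ)) * vir μ γ k
  have hA : ∀ g, A g = ∑ k ∈ Finset.range (n + 1), vir μ γ (-(k : ℤ)) (vir μ γ k g) := fun g => by
    simp [A, LinearMap.sum_apply]
  have key : ∀ d ∈ f.support, coeffNorm (A (monomial d 1)) ≤ ‖(n : ℂ) + weight μ γ‖ ^ 2 +
      (n + ‖μ‖ + ‖γ‖ * n) * (n * (3 / 2 * n + ‖μ‖ + ‖γ‖ * n)) := by
    intro d hd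
    have hdn : level d = n := by exact_mod_cast level_eq_of_mem_support μ γ hf hd
    have hd0 := vir_zero_monomial μ γ d
    rw [hA, Finset.sum_range_succ', add_comm]
    refine (coeffNorm_add_le _ _).trans (add_le_add ?_ ?_)
    · simp only [Nat.cast_zero, neg_zero, hd0, map_smul, hdn]
      rw [coeffNorm_smul, coeffNorm_smul, coeffNorm_monomial, norm_one, mul_one, sq]
    · have hsum := sum_coeffNorm_vir_le μ γ d
      rw [hdn] at hsum
      refine le_trans ((coeffNorm_sum_le _ _).trans (Finset.sum_le_sum fun i hi => ?_))
        ((Finset.mul_sum _ _ _).symm.le.trans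
          (mul_le_mul_of_nonneg_left hsum (by positivity)))
      refine coeffNorm_apply_le fun e he => ?_
      have hle := level_eq_of_mem_support μ γ (vir_zero_vir_of_eigen μ γ hd0 _) he
      have hle2 : (level e : ℤ) = level d - ((i : ℤ) + 1) := by
        push_cast at hle
        exact_mod_cast hle
      have hle3 : level e + (i + 1) = n := by omega
      refine (coeffNorm_vir_neg_le μ γ e (i + 1) (by omega)).trans ?_
      have hle4 : (level e : ℝ) + ((i : ℝ) + 1) = n := by exact_mod_cast hle3
      have hi0 : (0 : ℝ) ≤ i := Nat.cast_nonneg i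
      have he0 : (0 : ℝ) ≤ level e := Nat.cast_nonneg _
      have : ‖γ‖ * ((i : ℝ) + 1) ≤ ‖γ‖ * n :=
        mul_le_mul_of_nonneg_left (by linarith) (norm_nonneg _)
      push_cast
      linarith
  have h := coeffNorm_apply_le key
  rw [hA, hlam, coeffNorm_smul] at h
  exact le_of_mul_le_mul_right h (coeffNorm_pos hf0)

end Fock

/-! ### Comparison of the constants -/

/-- The eigenvalue bound in the irreducible lowest weight representation whose central charge and
lowest weight are those of the Fock space with parameters `μ` and `γ`. -/
theorem VirasoroRep.norm_sumLL_eigenvalue_le {V : Type*} [AddCommGroup V] [Module ℂ V]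
    {c h : ℂ} (μ γ : ℂ) (hc : c = 1 - 12 * γ ^ 2) (hh : h = Fock.weight μ γ)
    (ρ : VirasoroRep c V) (hlow : ρ.IsLowestWeightRep h) (hirr : ρ.IsIrreducible)
    (n : ℕ) {Ψ : V} (hΨ : Ψ ≠ 0) {lam : ℂ} (hL : ρ.L 0 Ψ = ((n : ℂ) + h) • Ψ)
    (hsum : ρ.sumLL Ψ = lam • Ψ) :
    ‖lam‖ ≤ ‖(n : ℂ) + h‖ ^ 2 + (n + ‖μ‖ + ‖γ‖ * n) * (n * (3 / 2 * n + ‖μ‖ + ‖γ‖ * n)) := by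
  subst hc hh
  have : FiniteDimensional ℂ (((Fock.virasoro μ γ).L 0).eigenspace ((n : ℂ) + Fock.weight μ γ)) :=
    Fock.finiteDimensional_eigenspace μ γ n
  obtain ⟨f, hf0, hf, hflam⟩ := exists_sumLL_eigenvector (Fock.virasoro μ γ) ρ one_ne_zero
    (Fock.vir_zero_one μ γ) (Fock.vir_pos_one μ γ) hlow hirr n
    (fun f hf k hk => Fock.vir_eq_zero_of_lt μ γ hf k hk) hΨ hL hsum
  exact Fock.norm_eigenvalue_le μ γ hf0 hf hflam

/-- The comparison of the bound on the Fock space with the one in terms of the central charge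
`c = 1 + 12 q²`, where `x = ‖μ‖` and `q = ‖γ‖`. -/
theorem fock_bound_le {n h x q : ℝ} (hn : 1 ≤ n) (hh : 0 < h) (hx : 0 ≤ x) (hq : 0 ≤ q)
    (hxq : x ^ 2 ≤ 2 * h + q ^ 2) :
    (n + h) ^ 2 + (n + x + q * n) * (n * (3 / 2 * n + x + q * n)) ≤
      (10 + 60 * q ^ 2) * (n + h) ^ 3 := by
  have h1 : (n + x + q * n) * (3 / 2 * n + x + q * n) ≤
      27 / 4 * n ^ 2 + 6 * h + 6 * q ^ 2 * n ^ 2 := by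
    have h2 : (n + x + q * n) * (3 / 2 * n + x + q * n) ≤ (3 / 2 * n + x + q * n) ^ 2 := by
      rw [sq]
      exact mul_le_mul_of_nonneg_right (by linarith) (by positivity)
    have h3 : (3 / 2 * n + x + q * n) ^ 2 ≤ 3 * ((3 / 2 * n) ^ 2 + x ^ 2 + (q * n) ^ 2) := by
      nlinarith [sq_nonneg (3 / 2 * n - x), sq_nonneg (3 / 2 * n - q * n), sq_nonneg (x - q * n)]
    have h4 : q ^ 2 * 1 ≤ q ^ 2 * n ^ 2 :=
      mul_le_mul_of_nonneg_left (by nlinarith) (sq_nonneg q)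
    nlinarith
  have h2 : n * ((n + x + q * n) * (3 / 2 * n + x + q * n)) ≤
      n * (27 / 4 * n ^ 2 + 6 * h + 6 * q ^ 2 * n ^ 2) :=
    mul_le_mul_of_nonneg_left h1 (by linarith)
  have hE : (n + h) ^ 2 ≤ (n + h) ^ 3 := pow_le_pow_right₀ (by linarith) (by norm_num)
  have hn0 : 0 ≤ n := by linarith
  have hE3 : n ^ 3 + 3 * n ^ 2 * h ≤ (n + h) ^ 3 := by
    have : 0 ≤ 3 * n * h ^ 2 + h ^ 3 := by positivity
    linarith [show (n + h) ^ 3 = n ^ 3 + 3 * n ^ 2 * h + (3 * n * h ^ 2 + h ^ 3) by ring]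
  have hnh : n * h ≤ n ^ 2 * h := by
    have : n ≤ n ^ 2 := by nlinarith
    exact mul_le_mul_of_nonneg_right this hh.le
  have hn3 : 0 ≤ n ^ 3 := by positivity
  have hq3 : q ^ 2 * n ^ 3 ≤ q ^ 2 * (n + h) ^ 3 :=
    mul_le_mul_of_nonneg_left (pow_le_pow_left₀ hn0 (by linarith) 3) (sq_nonneg q)
  have hq0 : 0 ≤ q ^ 2 * n ^ 3 := by positivity
  have hnh0 : 0 ≤ n ^ 2 * h := by positivity
  linarith

theorem proposition4p3 {V : Type*} [AddCommGroup V] [Module ℂ V]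
    (c h : ℝ) (hc : 1 < c) (hh : 0 < h)
    (ρ : VirasoroRep (c : ℂ) V) (hlow : ρ.IsLowestWeightRep (h : ℂ)) (hirr : ρ.IsIrreducible)
    (n : ℕ) (hn : 1 ≤ n ∨ 1 / (5 * (c + 1)) ≤ h)
    (Ψ : V) (hΨ : Ψ ≠ 0) (lam : ℂ)
    (hL : ρ.L 0 Ψ = ((n : ℂ) + (h : ℂ)) • Ψ)
    (hsum : ρ.sumLL Ψ = lam • Ψ) :
    ‖lam‖ ≤ 5 * (c + 1) * ((n : ℝ) + h) ^ 3 := by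
  obtain ⟨γ, hγ⟩ := IsAlgClosed.exists_pow_nat_eq (((1 - c) / 12 : ℝ) : ℂ) two_pos
  obtain ⟨μ, hμ⟩ := IsAlgClosed.exists_pow_nat_eq (2 * (h : ℂ) + γ ^ 2) two_pos
  have hγn : ‖γ‖ ^ 2 = (c - 1) / 12 := by
    rw [← norm_pow, hγ, Complex.norm_real, Real.norm_eq_abs, abs_of_neg (by linarith)]
    ring
  have hμn : ‖μ‖ ^ 2 ≤ 2 * h + ‖γ‖ ^ 2 := by
    rw [← norm_pow, ← norm_pow, hμ]
    refine (norm_add_le _ _).trans (add_le_add_left ?_ _)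
    rw [norm_mul, Complex.norm_real, Real.norm_of_nonneg hh.le, Complex.norm_ofNat]
  have hc' : (c : ℂ) = 1 - 12 * γ ^ 2 := by
    rw [hγ]; push_cast; ring
  have hh' : (h : ℂ) = Fock.weight μ γ := by
    rw [Fock.weight, hμ]; ring
  have key := VirasoroRep.norm_sumLL_eigenvalue_le μ γ hc' hh' ρ hlow hirr n hΨ hL hsum
  have hnorm : ‖(n : ℂ) + (h : ℂ)‖ = (n : ℝ) + h := by
    rw [← Complex.ofReal_natCast, ← Complex.ofReal_add, Complex.norm_real,
      Real.norm_of_nonneg (by positivity)]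
  rw [hnorm] at key
  refine key.trans ?_
  obtain rfl | hn0 := Nat.eq_zero_or_pos n
  · -- in level zero the bound is `h²`, which is where the hypothesis on `h` is needed
    have h1 : 1 / (5 * (c + 1)) ≤ h := hn.resolve_left (by norm_num)
    rw [div_le_iff₀ (by linarith)] at h1
    have h2 : 1 * h ^ 2 ≤ h * (5 * (c + 1)) * h ^ 2 := mul_le_mul_of_nonneg_right h1 (sq_nonneg h)
    simp only [Nat.cast_zero, zero_mul, mul_zero, add_zero, zero_add]
    linarith [show h * (5 * (c + 1)) * h ^ 2 = 5 * (c + 1) * h ^ 3 by ring]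
  · have := fock_bound_le (n := n) (by exact_mod_cast hn0) hh (norm_nonneg μ) (norm_nonneg γ) hμn
    rwa [hγn, show 10 + 60 * ((c - 1) / 12) = 5 * (c + 1) by ring] at this
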